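/- Let $\mathcal S=\mathbb R/2\mathbb Z$, identified with $(-1,1]$, with the metric $d(x,y)=\min\{|x-y|,\,2-|x-y|\}$ for $x,y\in(-1,1]$, and let $\mu\in(0,\tfrac12]$. The uniform compass model on $\mathbb Z$ with parameter $\mu$ is the $\mathcal S^{\mathbb Z}$-valued process $(\eta_t)_{t\ge 0}$ defined as follows. The initial opinions $\eta_0(v)$, $v\in\mathbb Z$, are i.i.d. uniform on $\mathcal S$. The edges $\langle v,v+1\rangle$, $v\in\mathbb Z$, carry independent rate-$1$ Poisson clocks, independent of the initial opinions. When the clock on $\langle v,v+1\rangle$ rings, the opinions at $v$ and $v+1$, which are then at some distance $\delta$, both move by the distance $\mu\delta$ towards each other along the geodesic (shorter arc) between them; if they are diametrically opposed ($\delta=1$), one of the two half-circles joining them is chosen by an independent fair coin. Opinions do not change otherwise. For every $\mu\in(0,\tfrac12]$: (a) There is weak consensus in mean: for every $v\in\mathbb Z$, $$\mathbb E\big[d(\eta_t(v),\eta_t(v+1))\big]\to 0\quad\text{as } t\to\infty .$$ (Equivalently, $\mathbb E|\Delta_t(e)|\to0$ for every edge $e=\langle v,v+1\rangle$, where $\Delta_t(e)\in(-1,1]$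 is the representative of $\eta_t(v+1)-\eta_t(v)$ modulo $2$.) (b) There is no strong consensus in probability: there is no $\mathcal S$-valued random variable $L$ on the underlying probability space (which may carry more randomness than the model) such that, for all $v\in\mathbb Z$, $d(\eta_t(v),L)\to0$ in probability as $t\to\infty$. -/

import Mathlib

open MeasureTheory ProbabilityTheory Filter Topology
open scoped NNReal ENNReal

namespace Compass

instance factZeroLtTwo : Fact ((0 : ℝ) < 2) := ⟨zero_lt_two⟩

/-- The opinion space `ℝ / 2ℤ`, with its quotient metric (distances lie in `[0, 1]`). -/
abbrev Opinion : Type := AddCircle (2 : ℝ)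

/-- The representative in `(-1, 1]` of `y - x`. -/
noncomputable def signedDiff (x y : Opinion) : ℝ :=
  (AddCircle.equivIoc (2 : ℝ) (-1) (y - x) : ℝ)

/-- The signed displacement along the geodesic from `x` to `y`. It is the signed difference, except
for diametrically opposed `x` and `y`, where a coin selects one of the two half-circles. -/
noncomputable def geodesicStep (c : Bool) (x y : Opinion) : ℝ :=
  if dist x y = 1 then (if c then 1 else -1) else signedDiff x y

/-- The new opinion at the left endpoint of an edge with opinions `x` (left) and `y` (right). -/
noncomputable def updateLeft (μ : ℝ) (c : Bool) (x y : Opinion) : Opinion :=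
  x + ((μ * geodesicStep c x y : ℝ) : Opinion)

/-- The new opinion at the right endpoint of an edge with opinions `x` (left) and `y` (right). -/
noncomputable def updateRight (μ : ℝ) (c : Bool) (x y : Opinion) : Opinion :=
  y - ((μ * geodesicStep c x y : ℝ) : Opinion)

/-- The randomness attached to a vertex `v` of `ℤ`: the initial opinion at `v`, the successive
waiting times of the clock on the edge `⟨v, v + 1⟩`, and the coins used at the rings of that
clock. -/
abbrev SiteData : Type := Opinion × (ℕ → ℝ) × (ℕ → Bool)

/-- The full randomness of the model. -/
abbrev Drive : Type := ℤ → SiteData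

/-- The initial opinion is uniform, the waiting times are i.i.d. exponential with rate `1` (so that
the clock is a Poisson process with rate `1`), the coins are i.i.d. fair, and the three are
independent. -/
noncomputable def siteLaw : Measure SiteData :=
  AddCircle.haarAddCircle.prod
    ((Measure.infinitePi fun _ : ℕ => expMeasure 1).prod
      (Measure.infinitePi fun _ : ℕ => (PMF.uniformOfFintype Bool).toMeasure))

/-- The site data are i.i.d. over the vertices of `ℤ`. -/
noncomputable def driveLaw : Measure Drive := Measure.infinitePi fun _ : ℤ => siteLaw

/-- The time of the ring number `k` (counted from `0`) of the clock on the edge `⟨e, e + 1⟩`. -/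
def ringTime (y : Drive) (e : ℤ) (k : ℕ) : ℝ := ∑ i ∈ Finset.range (k + 1), (y e).2.1 i

/-- The graphical construction: `η t v`, the opinion of `v` at time `t`, evolves according to the
initial opinions, the clocks and the coins in `y`. -/
structure IsCompassPath (μ : ℝ) (y : Drive) (η : ℝ≥0 → ℤ → Opinion) : Prop where
  /-- The path starts from the given initial opinions. -/
  initial : ∀ v, η 0 v = (y v).1
  /-- An opinion does not change while no clock on the two incident edges rings. -/
  const : ∀ (v : ℤ) (s t : ℝ≥0), s ≤ t →
    (∀ e k, (e = v - 1 ∨ e = v) → ¬ ((s : ℝ) < ringTime y e k ∧ ringTime y e k ≤ t)) →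
    η t v = η s v
  /-- When the clock on `⟨e, e + 1⟩` rings at time `t`, the two opinions held just before `t`, that
  is, at any `s < t` after which no other ring on this edge or on an adjacent one takes place up to
  time `t`, move towards each other along the geodesic. -/
  jump : ∀ (e : ℤ) (k : ℕ) (s t : ℝ≥0), s < t → ringTime y e k = t →
    (∀ e' k', (e' = e - 1 ∨ e' = e ∨ e' = e + 1) →
      ((s : ℝ) < ringTime y e' k' ∧ ringTime y e' k' ≤ t) → e' = e ∧ k' = k) →
    η t e = updateLeft μ ((y e).2.2 k) (η s e) (η s (e + 1)) ∧
    η t (e + 1) = updateRight μ ((y e).2.2 k) (η s e) (η s (e + 1))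

/-- `η` is a compass model on `ℤ` with parameter `μ` and i.i.d. uniform initial opinions, defined on
the probability space `(Ω, P)`. -/
def IsUniformCompassModel {Ω : Type*} [MeasurableSpace Ω] (P : Measure Ω) (μ : ℝ)
    (η : ℝ≥0 → Ω → ℤ → Opinion) : Prop :=
  ∃ Y : Ω → Drive, HasLaw Y driveLaw P ∧ ∀ᵐ ω ∂P, IsCompassPath μ (Y ω) fun t => η t ω

/-- The distance of the opinions of any two neighbours tends to `0` in `L¹`. -/
def WeakConsensusInMean {Ω : Type*} [MeasurableSpace Ω] (P : Measure Ω)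
    (η : ℝ≥0 → Ω → ℤ → Opinion) : Prop :=
  ∀ v : ℤ, (∀ t, Integrable (fun ω => dist (η t ω v) (η t ω (v + 1))) P) ∧
    Tendsto (fun t => ∫ ω, dist (η t ω v) (η t ω (v + 1)) ∂P) atTop (𝓝 0)

/-- All opinions converge in probability to a common random limit `L`. -/
def StrongConsensusInProbability {Ω : Type*} [MeasurableSpace Ω] (P : Measure Ω)
    (η : ℝ≥0 → Ω → ℤ → Opinion) : Prop :=
  ∃ L : Ω → Opinion, AEMeasurable L P ∧
    ∀ v : ℤ, TendstoInMeasure P (fun t ω => η t ω v) atTop L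

end Compass

/-! Weak consensus. Follow the gaps, the distances across the edges. A ring on an edge with gap Δ
leaves it a gap of at most (1 − 2μ)Δ and raises each adjacent gap by at most μΔ. So the gaps
exchange mass conservatively, up to a loss that is never negative (`loss_nonneg`). Translation
invariance cancels the exchange terms in the mean: the mean gap a(t) is nonincreasing, and its
decrease is the mean loss (`integral_loss_approx`).

To show that the limit c of a(t) is 0, ask for a pattern of rings in which the edges 0 and N are
silent for 2Q units of time while the edges between them ring again and again. The inner mass is
pushed to the ends, where a gap cannot exceed 1, so most of it has to be lost: `window_mass_le`
bounds the mass with weights N − i by N + 1 plus N times the losses. The pattern has a probability p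
> 0 that depends neither on the starting time nor on the mesh below, and it is independent of the
configuration at its start. Hence p (N(N+1)/2 · a(t) − (N+1)) ≤ N² (a(t) − a(t + 2Q)), the discrete
form being `patternProb_mul_le`. As t → ∞ the right side vanishes, so c ≤ 2/N for every N.

No strong consensus. If all opinions converged in probability to L, the mean distance from L would
be the same at every vertex, by translation invariance, and would become less than 1/4. Two opinions
at one time would then be at mean distance less than 1/2, however far apart their vertices. But with
finite speed of propagation, turning all initial opinions of a half-line by a half turn preserves
the law and makes the far opinion antipodal to itself, which forces a mean distance of at least 1/2
(`half_le_integral_dist_approx`).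

Both arguments are run on an automaton in discrete time with mesh 1/m, for which measurability,
symmetries, independence of past and future, and finite speed are elementary. At a fixed time and
vertex it almost surely agrees with the model for all large m
(`IsCompassPath.eventually_approx_eq`), and all distances are bounded by 1, so means pass to the
limit. -/

namespace Compass

/-! ### Geometry of the circle and of a single update -/

section Geometry

lemma norm_coe_le_abs (r : ℝ) : ‖(r : Opinion)‖ ≤ |r| := by
  rw [AddCircle.norm_eq]
  have h := round_le ((2 : ℝ)⁻¹ * r) 0
  have h2 : |r - round ((2 : ℝ)⁻¹ * r) * 2| = 2 * |(2 : ℝ)⁻¹ * r - round ((2 : ℝ)⁻¹ * r)| := by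
    rw [← abs_two (α := ℝ), ← abs_mul, abs_two]
    congr 1
    ring
  have h3 : |r| = 2 * |(2 : ℝ)⁻¹ * r - ((0 : ℤ) : ℝ)| := by
    rw [Int.cast_zero, sub_zero, abs_mul, abs_of_pos (by norm_num : (0 : ℝ) < 2⁻¹)]
    ring
  rw [h2, h3]
  linarith

lemma norm_coe_eq_abs {r : ℝ} (hr : |r| ≤ 1) : ‖(r : Opinion)‖ = |r| := by
  rw [AddCircle.norm_coe_eq_abs_iff _ two_ne_zero]
  simpa using hr

lemma dist_le_one (x y : Opinion) : dist x y ≤ 1 := by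
  rw [dist_eq_norm]
  simpa using AddCircle.norm_le_half_period (x := x - y) (p := 2) two_ne_zero

lemma coe_signedDiff (x y : Opinion) : (signedDiff x y : Opinion) = y - x := by
  simp [signedDiff]

lemma abs_signedDiff (x y : Opinion) : |signedDiff x y| = dist x y := by
  have h := (AddCircle.equivIoc (2 : ℝ) (-1) (y - x)).2
  have h1 : |signedDiff x y| ≤ 1 := by
    rw [abs_le]
    unfold signedDiff
    constructor
    · exact h.1.le
    · linarith [h.2]
  rw [← norm_coe_eq_abs h1, coe_signedDiff, dist_comm, dist_eq_norm]

lemma coe_neg_one_eq : ((-1 : ℝ) : Opinion) = ((1 : ℝ) : Opinion) := by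
  have h : ((1 : ℝ) : Opinion) = ((-1 + 2 : ℝ) : Opinion) := by norm_num
  rw [h, AddCircle.coe_add_period]

/-- The coin only chooses between 1 and −1, which agree modulo 2. -/
lemma coe_geodesicStep (c : Bool) (x y : Opinion) : (geodesicStep c x y : Opinion) = y - x := by
  unfold geodesicStep
  split_ifs with h hc
  · have h1 := coe_signedDiff x y
    have h2 := abs_signedDiff x y
    rw [h] at h2
    rcases eq_or_eq_neg_of_abs_eq h2 with h3 | h3
    · rw [← h1, h3]
    · rw [← h1, h3, coe_neg_one_eq]
  · have h1 := coe_signedDiff x y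
    have h2 := abs_signedDiff x y
    rw [h] at h2
    rcases eq_or_eq_neg_of_abs_eq h2 with h3 | h3
    · rw [← h1, h3, coe_neg_one_eq]
    · rw [← h1, h3]
  · exact coe_signedDiff x y

lemma abs_geodesicStep (c : Bool) (x y : Opinion) : |geodesicStep c x y| = dist x y := by
  unfold geodesicStep
  split_ifs with h hc
  · simp [h]
  · simp [h]
  · exact abs_signedDiff x y

/-- Rotation equivariance of the dynamics starts here; the half-turn argument against strong
consensus rests on it. -/
lemma geodesicStep_add_right (c : Bool) (x y r : Opinion) :
    geodesicStep c (x + r) (y + r) = geodesicStep c x y := by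
  simp [geodesicStep, signedDiff]

lemma updateLeft_add_right (μ : ℝ) (c : Bool) (x y r : Opinion) :
    updateLeft μ c (x + r) (y + r) = updateLeft μ c x y + r := by
  simp only [updateLeft, geodesicStep_add_right]
  abel

lemma updateRight_add_right (μ : ℝ) (c : Bool) (x y r : Opinion) :
    updateRight μ c (x + r) (y + r) = updateRight μ c x y + r := by
  simp only [updateRight, geodesicStep_add_right]
  abel

lemma dist_updateLeft_le {μ : ℝ} (hμ : 0 ≤ μ) (c : Bool) (x y : Opinion) :
    dist (updateLeft μ c x y) x ≤ μ * dist x y := by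
  rw [updateLeft, dist_eq_norm, add_sub_cancel_left, ← abs_geodesicStep c]
  refine (norm_coe_le_abs _).trans ?_
  rw [abs_mul, abs_of_nonneg hμ]

lemma dist_updateRight_le {μ : ℝ} (hμ : 0 ≤ μ) (c : Bool) (x y : Opinion) :
    dist (updateRight μ c x y) y ≤ μ * dist x y := by
  rw [updateRight, dist_comm, dist_eq_norm, sub_sub_cancel, ← abs_geodesicStep c]
  refine (norm_coe_le_abs _).trans ?_
  rw [abs_mul, abs_of_nonneg hμ]

/-- Both ends move by μ times the same geodesic step, which leaves a displacement of 1 − 2μ times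
that step; μ ≤ 1/2 makes the factor nonnegative. -/
lemma dist_update_le {μ : ℝ} (hμ : μ ≤ 1 / 2) (c : Bool) (x y : Opinion) :
    dist (updateLeft μ c x y) (updateRight μ c x y) ≤ (1 - 2 * μ) * dist x y := by
  have h : updateRight μ c x y - updateLeft μ c x y
      = (((1 - 2 * μ) * geodesicStep c x y : ℝ) : Opinion) := by
    have h1 : ((1 - 2 * μ) * geodesicStep c x y : ℝ)
      = geodesicStep c x y - μ * geodesicStep c x y - μ * geodesicStep c x y := by ring
    rw [h1, AddCircle.coe_sub, AddCircle.coe_sub, coe_geodesicStep, updateRight, updateLeft]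
    abel
  rw [dist_comm, dist_eq_norm, h, ← abs_geodesicStep c]
  refine (norm_coe_le_abs _).trans ?_
  rw [abs_mul, abs_of_nonneg (by linarith)]

end Geometry

/-! ### One step of the automaton and the balance of the gaps -/

section Automaton

/-- The edge `e` is active if its clock rings and those of its two neighbours do not. -/
def Active (b : ℤ → Option Bool) (e : ℤ) : Prop :=
  b e ≠ none ∧ b (e - 1) = none ∧ b (e + 1) = none

instance (b : ℤ → Option Bool) (e : ℤ) : Decidable (Active b e) := by
  unfold Active; infer_instance

lemma Active.not_active_add {b : ℤ → Option Bool} {e : ℤ} (h : Active b e) :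
    ¬ Active b (e + 1) := fun h' => h'.1 h.2.2

lemma Active.not_active_sub {b : ℤ → Option Bool} {e : ℤ} (h : Active b e) :
    ¬ Active b (e - 1) := fun h' => h'.1 h.2.1

/-- All active edges are updated simultaneously. -/
noncomputable def step (μ : ℝ) (b : ℤ → Option Bool) (ξ : ℤ → Opinion) (v : ℤ) : Opinion :=
  if Active b v then updateLeft μ ((b v).getD false) (ξ v) (ξ (v + 1))
  else if Active b (v - 1) then updateRight μ ((b (v - 1)).getD false) (ξ (v - 1)) (ξ v)
  else ξ v

/-- The distance across the edge `⟨e, e + 1⟩`. -/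
noncomputable def gap (ξ : ℤ → Opinion) (e : ℤ) : ℝ := dist (ξ e) (ξ (e + 1))

/-- The amount which the edge `e` hands over to each of its neighbours in one step. -/
noncomputable def flow (μ : ℝ) (b : ℤ → Option Bool) (ξ : ℤ → Opinion) (e : ℤ) : ℝ :=
  if Active b e then μ * gap ξ e else 0

/-- The defect in the conservation of the gaps at the edge `e` in one step. -/
noncomputable def loss (μ : ℝ) (b : ℤ → Option Bool) (ξ : ℤ → Opinion) (e : ℤ) : ℝ :=
  gap ξ e - 2 * flow μ b ξ e + flow μ b ξ (e - 1) + flow μ b ξ (e + 1) - gap (step μ b ξ) e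

variable {μ : ℝ} {b : ℤ → Option Bool} {ξ : ℤ → Opinion}

lemma gap_nonneg (ξ : ℤ → Opinion) (e : ℤ) : 0 ≤ gap ξ e := dist_nonneg

lemma gap_le_one (ξ : ℤ → Opinion) (e : ℤ) : gap ξ e ≤ 1 := dist_le_one _ _

lemma flow_nonneg (hμ : 0 ≤ μ) (e : ℤ) : 0 ≤ flow μ b ξ e := by
  unfold flow
  split_ifs
  · exact mul_nonneg hμ (gap_nonneg _ _)
  · exact le_rfl

lemma flow_of_active {e : ℤ} (h : Active b e) : flow μ b ξ e = μ * gap ξ e := if_pos h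

lemma flow_of_not_active {e : ℤ} (h : ¬ Active b e) : flow μ b ξ e = 0 := if_neg h

lemma dist_step_le (hμ : 0 ≤ μ) (v : ℤ) :
    dist (step μ b ξ v) (ξ v) ≤ flow μ b ξ v + flow μ b ξ (v - 1) := by
  unfold step
  split_ifs with h1 h2
  · rw [flow_of_active h1]
    exact (dist_updateLeft_le hμ _ _ _).trans (le_add_of_nonneg_right (flow_nonneg hμ _))
  · rw [flow_of_active h2]
    refine le_trans ?_ (le_add_of_nonneg_left (flow_nonneg hμ _))
    simpa [gap] using dist_updateRight_le hμ ((b (v - 1)).getD false) (ξ (v - 1)) (ξ v)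
  · rw [dist_self]
    exact add_nonneg (flow_nonneg hμ _) (flow_nonneg hμ _)

lemma gap_step_le_add (hμ : 0 ≤ μ) (e : ℤ) : gap (step μ b ξ) e
    ≤ gap ξ e + 2 * flow μ b ξ e + flow μ b ξ (e - 1) + flow μ b ξ (e + 1) := by
  have h1 := dist_step_le (b := b) (ξ := ξ) hμ e
  have h2 := dist_step_le (b := b) (ξ := ξ) hμ (e + 1)
  rw [add_sub_cancel_right, dist_comm] at h2
  have h3 := dist_triangle4 (step μ b ξ e) (ξ e) (ξ (e + 1)) (step μ b ξ (e + 1))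
  unfold gap
  linarith

/-- Reverse estimate, used to carry smallness of a gap back in time when little mass is exchanged.
-/
lemma gap_le_gap_step_add (hμ : 0 ≤ μ) (e : ℤ) : gap ξ e
    ≤ gap (step μ b ξ) e + 2 * flow μ b ξ e + flow μ b ξ (e - 1) + flow μ b ξ (e + 1) := by
  have h1 := dist_step_le (b := b) (ξ := ξ) hμ e
  have h2 := dist_step_le (b := b) (ξ := ξ) hμ (e + 1)
  rw [add_sub_cancel_right] at h2
  rw [dist_comm] at h1
  have h3 := dist_triangle4 (ξ e) (step μ b ξ e) (step μ b ξ (e + 1)) (ξ (e + 1))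
  unfold gap
  linarith

/-- An active edge has inactive neighbours, and its own gap contracts by 1 − 2μ. An inactive edge
emits nothing, and the triangle inequality bounds its growth by what the neighbours hand over. -/
lemma loss_nonneg (hμ : 0 ≤ μ) (hμ' : μ ≤ 1 / 2) (e : ℤ) : 0 ≤ loss μ b ξ e := by
  by_cases h : Active b e
  · have h1 : step μ b ξ e = updateLeft μ ((b e).getD false) (ξ e) (ξ (e + 1)) := if_pos h
    have h2 : step μ b ξ (e + 1) = updateRight μ ((b e).getD false) (ξ e) (ξ (e + 1)) := by
      rw [step, if_neg h.not_active_add, add_sub_cancel_right, if_pos h]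
    have h3 := dist_update_le hμ' ((b e).getD false) (ξ e) (ξ (e + 1))
    rw [loss, flow_of_active h, flow_of_not_active h.not_active_sub,
      flow_of_not_active h.not_active_add]
    unfold gap
    rw [h1, h2]
    linarith
  · have h1 := gap_step_le_add (b := b) (ξ := ξ) hμ e
    have h2 := flow_of_not_active (μ := μ) (ξ := ξ) h
    rw [loss]
    linarith

lemma step_add_right (r : Opinion) (v : ℤ) :
    step μ b (fun u => ξ u + r) v = step μ b ξ v + r := by
  simp only [step, updateLeft_add_right, updateRight_add_right]
  split_ifs <;> rfl

lemma step_congr {ξ' : ℤ → Opinion} {v : ℤ} (h0 : ξ (v - 1) = ξ' (v - 1)) (h1 : ξ v = ξ' v)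
    (h2 : ξ (v + 1) = ξ' (v + 1)) : step μ b ξ v = step μ b ξ' v := by
  simp only [step, h0, h1, h2]

end Automaton

/-! ### Deterministic loss of mass in an isolated window -/

section Window

/-- Summation by parts for the discrete Laplacian. -/
lemma sum_mul_laplacian (u f : ℤ → ℝ) (n : ℕ) :
    ∑ i ∈ Finset.range n, u i * (-2 * f i + f ((i : ℤ) - 1) + f ((i : ℤ) + 1))
      = ∑ i ∈ Finset.range n, f i * (-2 * u i + u ((i : ℤ) - 1) + u ((i : ℤ) + 1))
        + (u 0 * f (-1) - u (-1) * f 0) + (u ((n : ℤ) - 1) * f n - u n * f ((n : ℤ) - 1)) := by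
  induction n with
  | zero => simp
  | succ n ih =>
    rw [Finset.sum_range_succ, Finset.sum_range_succ, ih]
    push_cast
    rw [add_sub_cancel_right]
    ring

/-- Gaps `g` in a window `0, …, N` which evolve by exchange of mass with the neighbouring edges,
up to the losses `l`, and of which those at `0` and `N` emit nothing. If all other edges of the
window emit their share at least once in each of `Q` periods, then most of the mass in the window
must have been lost. -/
lemma window_mass_le {μ : ℝ} (hμ : 0 < μ) {g f l : ℕ → ℤ → ℝ}
    (hg0 : ∀ j i, 0 ≤ g j i) (hg1 : ∀ j i, g j i ≤ 1)
    (hf : ∀ j i, 0 ≤ f j i) (hl : ∀ j i, 0 ≤ l j i)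
    (hstep : ∀ j i, g (j + 1) i + l j i = g j i - 2 * f j i + f j (i - 1) + f j (i + 1))
    (hback : ∀ j i, g j i ≤ g (j + 1) i + 2 * f j i + f j (i - 1) + f j (i + 1))
    {N M Q : ℕ} (hN : 1 ≤ N) (hQ : (N : ℝ) ^ 5 * (1 / μ + 4) ≤ Q)
    (hf0 : ∀ j < Q * M, f j 0 = 0) (hfN : ∀ j < Q * M, f j N = 0)
    (hact : ∀ q < Q, ∀ i : ℕ, 1 ≤ i → i < N →
      ∃ j, q * M ≤ j ∧ j < (q + 1) * M ∧ f j i = μ * g j i) :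
    ∑ i ∈ Finset.range N, ((N : ℝ) - i) * g 0 i
      ≤ N + 1 + N * ∑ j ∈ Finset.range (Q * M), ∑ i ∈ Finset.range N, l j i := by
  have hNr : (1 : ℝ) ≤ N := by exact_mod_cast hN
  have hQ0 : 0 < Q := by
    have : (0 : ℝ) < Q := lt_of_lt_of_le (by positivity) hQ
    exact_mod_cast this
  -- The weight N − i is harmonic and vanishes at N, so exchange inside the window preserves `H`;
  -- only losses can lower it.
  set H : ℕ → ℝ := fun j => ∑ i ∈ Finset.range N, ((N : ℝ) - i) * g j i with hH
  -- The weight i(N − i) has discrete Laplacian −2 and vanishes at 0 and N, so `G` drops by at least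
  -- twice the emitted mass; this bounds the total exchange.
  set G : ℕ → ℝ := fun j => ∑ i ∈ Finset.range N, ((i : ℝ) * (N - i)) * g j i with hG
  set F : ℕ → ℝ := fun j => ∑ i ∈ Finset.range N, f j i with hF
  set Λ : ℕ → ℝ := fun j => ∑ i ∈ Finset.range N, l j i with hΛ
  have hF0 : ∀ j, 0 ≤ F j := fun j => Finset.sum_nonneg fun i _ => hf j i
  have hΛ0 : ∀ j, 0 ≤ Λ j := fun j => Finset.sum_nonneg fun i _ => hl j i
  have hG0 : ∀ j, 0 ≤ G j := fun j => Finset.sum_nonneg fun i hi => by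
    have : (i : ℝ) ≤ N := by exact_mod_cast (Finset.mem_range.1 hi).le
    exact mul_nonneg (mul_nonneg (by positivity) (by linarith)) (hg0 _ _)
  -- the two monotone quantities
  have hHstep : ∀ j < Q * M, H j ≤ H (j + 1) + N * Λ j := by
    intro j hj
    have e1 := sum_mul_laplacian (fun i => (N : ℝ) - i) (f j) N
    have e2 : ∑ i ∈ Finset.range N, f j i * (-2 * ((N : ℝ) - ((i : ℤ) : ℝ))
        + ((N : ℝ) - (((i : ℤ) - 1 : ℤ) : ℝ)) + ((N : ℝ) - (((i : ℤ) + 1 : ℤ) : ℝ))) = 0 :=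
      Finset.sum_eq_zero fun i _ => by push_cast; ring
    rw [e2, hf0 j hj, hfN j hj] at e1
    have e3 : H (j + 1) = H j + ∑ i ∈ Finset.range N, ((N : ℝ) - ((i : ℤ) : ℝ)) *
        (-2 * f j i + f j ((i : ℤ) - 1) + f j ((i : ℤ) + 1))
        - ∑ i ∈ Finset.range N, ((N : ℝ) - i) * l j i := by
      rw [hH]
      simp only
      rw [← Finset.sum_add_distrib, ← Finset.sum_sub_distrib]
      refine Finset.sum_congr rfl fun i _ => ?_
      rw [eq_sub_of_add_eq (hstep j i)]
      push_cast
      ring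
    have e4 : ∑ i ∈ Finset.range N, ((N : ℝ) - i) * l j i ≤ N * Λ j := by
      rw [hΛ, Finset.mul_sum]
      refine Finset.sum_le_sum fun i _ => mul_le_mul_of_nonneg_right ?_ (hl _ _)
      simp
    -- The only boundary term left is the inflow from the edge −1, which helps.
    have e5 := mul_nonneg (Nat.cast_nonneg (α := ℝ) N) (hf j (-1))
    simp only [Int.cast_natCast, Int.cast_zero, sub_zero, mul_zero, Int.cast_sub, Int.cast_one,
      sub_self, zero_mul, zero_add, add_zero] at e1
    rw [e3]
    simp only [Int.cast_natCast]
    rw [e1]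
    linarith
  have hGstep : ∀ j < Q * M, G (j + 1) + 2 * F j ≤ G j := by
    intro j hj
    have e1 := sum_mul_laplacian (fun i => (i : ℝ) * (N - i)) (f j) N
    have e2 : ∑ i ∈ Finset.range N, f j i * (-2 * (((i : ℤ) : ℝ) * (N - ((i : ℤ) : ℝ)))
        + ((((i : ℤ) - 1 : ℤ) : ℝ) * (N - (((i : ℤ) - 1 : ℤ) : ℝ)))
        + ((((i : ℤ) + 1 : ℤ) : ℝ) * (N - (((i : ℤ) + 1 : ℤ) : ℝ)))) = - (2 * F j) := by
      rw [hF, Finset.mul_sum, ← Finset.sum_neg_distrib]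
      refine Finset.sum_congr rfl fun i _ => ?_
      push_cast
      ring
    rw [e2, hf0 j hj, hfN j hj] at e1
    have e3 : G (j + 1) = G j + ∑ i ∈ Finset.range N, (((i : ℤ) : ℝ) * (N - ((i : ℤ) : ℝ))) *
        (-2 * f j i + f j ((i : ℤ) - 1) + f j ((i : ℤ) + 1))
        - ∑ i ∈ Finset.range N, ((i : ℝ) * (N - i)) * l j i := by
      rw [hG]
      simp only
      rw [← Finset.sum_add_distrib, ← Finset.sum_sub_distrib]
      refine Finset.sum_congr rfl fun i _ => ?_
      rw [eq_sub_of_add_eq (hstep j i)]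
      push_cast
      ring
    have e4 : 0 ≤ ∑ i ∈ Finset.range N, ((i : ℝ) * (N - i)) * l j i :=
      Finset.sum_nonneg fun i hi => by
        have : (i : ℝ) ≤ N := by exact_mod_cast (Finset.mem_range.1 hi).le
        exact mul_nonneg (mul_nonneg (by positivity) (by linarith)) (hl _ _)
    simp only [Int.cast_natCast, Int.cast_zero, sub_zero, mul_zero,
      sub_self, zero_mul, add_zero] at e1
    rw [e3]
    simp only [Int.cast_natCast]
    rw [e1]
    linarith
  have hHsum : ∀ s ≤ Q * M, H 0 ≤ H s + N * ∑ j ∈ Finset.range s, Λ j := by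
    intro s
    induction s with
    | zero => simp
    | succ s ih =>
      intro hs
      have := hHstep s hs
      rw [Finset.sum_range_succ, mul_add]
      linarith [ih (Nat.le_of_succ_le hs)]
  have hGsum : ∀ s ≤ Q * M, G s + 2 * ∑ j ∈ Finset.range s, F j ≤ G 0 := by
    intro s
    induction s with
    | zero => simp
    | succ s ih =>
      intro hs
      have := hGstep s hs
      rw [Finset.sum_range_succ, mul_add]
      linarith [ih (Nat.le_of_succ_le hs)]
  have hG00 : G 0 ≤ (N : ℝ) ^ 3 := by
    have : G 0 ≤ ∑ i ∈ Finset.range N, (N : ℝ) ^ 2 := by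
      refine Finset.sum_le_sum fun i hi => ?_
      have h1 : (i : ℝ) ≤ N := by exact_mod_cast (Finset.mem_range.1 hi).le
      have h2 : (0 : ℝ) ≤ i := by positivity
      have h3 : (i : ℝ) * (N - i) ≤ N ^ 2 := by nlinarith
      have h4 : (0 : ℝ) ≤ (i : ℝ) * (N - i) := mul_nonneg h2 (by linarith)
      nlinarith [hg0 0 i, hg1 0 i]
    refine this.trans_eq ?_
    rw [Finset.sum_const, Finset.card_range, nsmul_eq_mul]
    ring
  have hFsum : ∑ j ∈ Finset.range (Q * M), F j ≤ (N : ℝ) ^ 3 := by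
    have h1 := hGsum _ le_rfl
    have h2 := hG0 (Q * M)
    have h3 : 0 ≤ ∑ j ∈ Finset.range (Q * M), F j := Finset.sum_nonneg fun j _ => hF0 j
    linarith
  -- a period with little exchange of mass
  have hblock : ∀ K : ℕ, ∑ j ∈ Finset.range (K * M), F j
      = ∑ q ∈ Finset.range K, ∑ j ∈ Finset.Ico (q * M) ((q + 1) * M), F j := by
    intro K
    induction K with
    | zero => simp
    | succ K ih =>
      rw [Finset.sum_range_succ, ← ih, Finset.sum_range_add_sum_Ico]
      exact Nat.mul_le_mul_right _ (Nat.le_succ K)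
  -- Pigeonhole: the total exchange is at most N³, spread over Q periods.
  obtain ⟨q, hqQ, hq⟩ : ∃ q < Q, ∑ j ∈ Finset.Ico (q * M) ((q + 1) * M), F j ≤ N ^ 3 / Q := by
    by_contra! hcon
    have h1 : ∑ q ∈ Finset.range Q, ((N : ℝ) ^ 3 / Q)
        < ∑ q ∈ Finset.range Q, ∑ j ∈ Finset.Ico (q * M) ((q + 1) * M), F j :=
      Finset.sum_lt_sum_of_nonempty ⟨0, by simpa using hQ0⟩
        fun q hq => hcon q (Finset.mem_range.1 hq)
    rw [← hblock, Finset.sum_const, Finset.card_range, nsmul_eq_mul, mul_div_cancel₀] at h1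
    · exact absurd hFsum (not_le.2 h1)
    · exact_mod_cast hQ0.ne'
  have hlt : ∀ j, j < (q + 1) * M → j < Q * M := fun j hj =>
    hj.trans_le (Nat.mul_le_mul_right _ hqQ)
  have hfF : ∀ j < (q + 1) * M, ∀ i : ℕ, i ≤ N → f j i ≤ F j := by
    intro j hj i hi
    rcases hi.eq_or_lt with rfl | hi
    · rw [hfN j (hlt j hj)]
      exact hF0 j
    · exact Finset.single_le_sum (f := fun i : ℕ => f j i) (fun i _ => hf j i)
        (Finset.mem_range.2 hi)
  -- In this period the edge emits μ times its gap at some time, so its gap is then at most 1/μ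
  -- times the exchange. Going back to the start of the period costs 2 + 1 + 1 = 4 times the
  -- exchange.
  have hsmall : ∀ i : ℕ, 1 ≤ i → i < N → g (q * M) i ≤ (1 / μ + 4) * (N ^ 3 / Q) := by
    intro i hi1 hiN
    obtain ⟨j, hj1, hj2, hj3⟩ := hact q hqQ i hi1 hiN
    have hb : ∀ k, q * M ≤ k → k ≤ j →
        g (q * M) i ≤ g k i + 4 * ∑ j' ∈ Finset.Ico (q * M) k, F j' := by
      intro k hk
      induction k, hk using Nat.le_induction with
      | base => simp
      | succ k hk ih =>
        intro hkj
        have hk' : k < (q + 1) * M := by omega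
        rw [Finset.sum_Ico_succ_top hk, mul_add]
        have a1 := hback k i
        have a2 := hfF k hk' i hiN.le
        have a3 := hfF k hk' (i + 1) hiN
        have a4 := hfF k hk' (i - 1) (by omega)
        rw [Nat.cast_sub hi1] at a4
        push_cast at a3 a4
        linarith [ih (by omega)]
    have h1 := hb j hj1 le_rfl
    have h2 : ∑ j' ∈ Finset.Ico (q * M) j, F j' ≤ N ^ 3 / Q :=
      (Finset.sum_le_sum_of_subset_of_nonneg (Finset.Ico_subset_Ico_right hj2.le)
        fun j _ _ => hF0 j).trans hq
    have h3 : f j i ≤ N ^ 3 / Q :=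
      (hfF j hj2 i hiN.le).trans ((Finset.single_le_sum (f := F) (fun j _ => hF0 j)
        (Finset.mem_Ico.2 ⟨hj1, hj2⟩)).trans hq)
    have h4 : g j i = 1 / μ * f j i := by
      rw [hj3]
      field_simp
    have h5 : g j i ≤ 1 / μ * (N ^ 3 / Q) := by
      rw [h4]
      exact mul_le_mul_of_nonneg_left h3 (by positivity)
    linarith
  -- The edge 0 contributes at most N, and the choice of Q makes all inner edges together contribute
  -- at most 1.
  have hHend : H (q * M) ≤ N + 1 := by
    obtain ⟨n, rfl⟩ : ∃ n, N = n + 1 := ⟨N - 1, by omega⟩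
    rw [hH]
    simp only
    rw [Finset.sum_range_succ']
    have hQr : (0 : ℝ) < Q := by exact_mod_cast hQ0
    have h1 : ∑ k ∈ Finset.range n, ((((n + 1 : ℕ) : ℝ)) - ((k + 1 : ℕ) : ℝ)) *
        g (q * M) ((k + 1 : ℕ) : ℤ)
        ≤ ∑ k ∈ Finset.range n, ((n + 1 : ℕ) : ℝ) *
          ((1 / μ + 4) * (((n + 1 : ℕ) : ℝ) ^ 3 / Q)) := by
      refine Finset.sum_le_sum fun k hk => ?_
      have hk := Finset.mem_range.1 hk
      refine mul_le_mul ?_ (hsmall (k + 1) (by omega) (by omega)) (hg0 _ _) (by positivity)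
      simp only [sub_le_self_iff]
      positivity
    rw [Finset.sum_const, Finset.card_range, nsmul_eq_mul] at h1
    have h2 : (n : ℝ) * (((n + 1 : ℕ) : ℝ) * ((1 / μ + 4) * (((n + 1 : ℕ) : ℝ) ^ 3 / Q))) ≤ 1 := by
      have h3 : (n : ℝ) * (((n + 1 : ℕ) : ℝ) * ((1 / μ + 4) * (((n + 1 : ℕ) : ℝ) ^ 3 / Q)))
          ≤ ((n + 1 : ℕ) : ℝ) * (((n + 1 : ℕ) : ℝ) *
            ((1 / μ + 4) * (((n + 1 : ℕ) : ℝ) ^ 3 / Q))) := by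
        refine mul_le_mul_of_nonneg_right ?_ (by positivity)
        push_cast
        linarith
      refine h3.trans ?_
      have h4 : ((n + 1 : ℕ) : ℝ) * (((n + 1 : ℕ) : ℝ) *
            ((1 / μ + 4) * (((n + 1 : ℕ) : ℝ) ^ 3 / Q)))
          = (((n + 1 : ℕ) : ℝ) ^ 5 * (1 / μ + 4)) / Q := by ring
      rw [h4, div_le_one hQr]
      exact hQ
    have h5 : (((n + 1 : ℕ) : ℝ) - ((0 : ℕ) : ℝ)) * g (q * M) ((0 : ℕ) : ℤ)
        ≤ ((n + 1 : ℕ) : ℝ) := by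
      rw [Nat.cast_zero, sub_zero]
      exact mul_le_of_le_one_right (by positivity) (hg1 _ _)
    linarith
  have hqs : q * M ≤ Q * M := Nat.mul_le_mul_right _ hqQ.le
  have hfin := hHsum (q * M) hqs
  have hmono : ∑ j ∈ Finset.range (q * M), Λ j ≤ ∑ j ∈ Finset.range (Q * M), Λ j :=
    Finset.sum_le_sum_of_subset_of_nonneg (Finset.range_subset_range.2 hqs) fun j _ _ => hΛ0 j
  have := mul_le_mul_of_nonneg_left hmono (Nat.cast_nonneg (α := ℝ) N)
  linarith

end Window

/-! ### Splitting off the first term of an i.i.d. sequence -/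

section ConsSeq

variable {α : Type*}

/-- The sequence with first term `a`, followed by the terms of `f`. -/
def consSeq (a : α) (f : ℕ → α) : ℕ → α
  | 0 => a
  | n + 1 => f n

@[simp] lemma consSeq_zero (a : α) (f : ℕ → α) : consSeq a f 0 = a := rfl

@[simp] lemma consSeq_succ (a : α) (f : ℕ → α) (n : ℕ) : consSeq a f (n + 1) = f n := rfl

@[fun_prop]
lemma measurable_consSeq [MeasurableSpace α] {β : Type*} [MeasurableSpace β] {g : β → α}
    {f : β → ℕ → α} (hg : Measurable g) (hf : Measurable f) :
    Measurable fun x => consSeq (g x) (f x) := by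
  refine measurable_pi_lambda _ fun n => ?_
  cases n with
  | zero => exact hg
  | succ n => exact (measurable_pi_apply n).comp hf

lemma map_consSeq_infinitePi [MeasurableSpace α] (ν : Measure α) [IsProbabilityMeasure ν] :
    (ν.prod (Measure.infinitePi fun _ : ℕ => ν)).map (fun p => consSeq p.1 p.2)
      = Measure.infinitePi fun _ : ℕ => ν := by
  classical
  refine Measure.eq_infinitePi _ fun s t ht => ?_
  rw [Measure.map_apply (by fun_prop) (MeasurableSet.pi s.countable_toSet fun _ _ => ht _)]
  have h1 : (fun p : α × (ℕ → α) => consSeq p.1 p.2) ⁻¹' (Set.pi s t)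
      = (if 0 ∈ s then t 0 else Set.univ) ×ˢ
        Set.pi ((s.erase 0).image Nat.pred) (fun n => t (n + 1)) := by
    ext ⟨a, f⟩
    simp only [Set.mem_preimage, Set.mem_pi, Finset.mem_coe, Set.mem_prod, Finset.coe_image,
      Set.mem_image, Finset.coe_erase, Set.mem_sdiff, Set.mem_singleton_iff]
    constructor
    · intro h
      refine ⟨?_, ?_⟩
      · split_ifs with h0
        · exact h 0 h0
        · trivial
      · rintro n ⟨m, ⟨hm, hm0⟩, rfl⟩
        obtain ⟨k, rfl⟩ := Nat.exists_eq_succ_of_ne_zero hm0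
        exact h _ hm
    · rintro ⟨h0, h⟩ n hn
      cases n with
      | zero => simpa [hn] using h0
      | succ n => exact h n ⟨n + 1, ⟨hn, by simp⟩, rfl⟩
  rw [h1, Measure.prod_prod, Measure.infinitePi_pi _ (fun i _ => ht _),
    Finset.prod_image (g := Nat.pred)]
  · have h2 : ∏ x ∈ s.erase 0, ν (t (x.pred + 1)) = ∏ x ∈ s.erase 0, ν (t x) :=
      Finset.prod_congr rfl fun x hx => by
        rw [Nat.pred_eq_sub_one, Nat.sub_add_cancel]
        exact Nat.one_le_iff_ne_zero.2 (Finset.ne_of_mem_erase hx)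
    rw [h2]
    split_ifs with h0
    · rw [Finset.mul_prod_erase s (fun x => ν (t x)) h0]
    · rw [measure_univ, one_mul, Finset.erase_eq_of_notMem h0]
  · intro x hx y hy hxy
    have hx := Finset.ne_of_mem_erase hx
    have hy := Finset.ne_of_mem_erase hy
    simp only [Nat.pred_eq_sub_one] at hxy
    omega

end ConsSeq

/-! ### The exponential law -/

section Exponential

instance isProbabilityMeasure_exp : IsProbabilityMeasure (expMeasure 1) :=
  isProbabilityMeasure_expMeasure one_pos

lemma expMeasure_Iic (x : ℝ) :
    expMeasure 1 (Set.Iic x) = ENNReal.ofReal (if 0 ≤ x then 1 - Real.exp (-x) else 0) := by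
  rw [← ofReal_measureReal, ← cdf_eq_real, cdf_expMeasure_eq one_pos, one_mul]

lemma expMeasure_Ioi {x : ℝ} (hx : 0 ≤ x) :
    expMeasure 1 (Set.Ioi x) = ENNReal.ofReal (Real.exp (-x)) := by
  rw [← Set.compl_Iic, prob_compl_eq_one_sub measurableSet_Iic, expMeasure_Iic, if_pos hx,
    ← ENNReal.ofReal_one, ← ENNReal.ofReal_sub]
  · congr 1
    ring
  · have := Real.exp_le_one_iff.2 (neg_nonpos.2 hx)
    linarith

lemma expMeasure_Iic_zero : expMeasure 1 (Set.Iic 0) = 0 := by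
  rw [expMeasure_Iic]
  simp

/-- The exponential distribution is memoryless. -/
lemma map_sub_restrict_expMeasure {h : ℝ} (hh : 0 ≤ h) :
    ((expMeasure 1).restrict (Set.Ioi h)).map (fun a => a - h)
      = expMeasure 1 (Set.Ioi h) • expMeasure 1 := by
  have : IsFiniteMeasure (((expMeasure 1).restrict (Set.Ioi h)).map (fun a => a - h)) :=
    Measure.isFiniteMeasure_map _ _
  refine Measure.ext_of_Iic _ _ fun x => ?_
  have hm : Measurable fun a : ℝ => a - h := by fun_prop
  rw [Measure.map_apply hm measurableSet_Iic,
    Measure.restrict_apply (hm measurableSet_Iic), Measure.smul_apply, smul_eq_mul]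
  have hs : (fun a : ℝ => a - h) ⁻¹' Set.Iic x ∩ Set.Ioi h = Set.Iic (h + x) \ Set.Iic h := by
    ext a
    simp only [Set.mem_inter_iff, Set.mem_preimage, Set.mem_Iic, Set.mem_Ioi, Set.mem_sdiff, not_le]
    exact and_congr_left fun _ => by rw [sub_le_iff_le_add']
  rw [hs, expMeasure_Ioi hh, expMeasure_Iic x]
  split_ifs with hx
  · rw [measure_sdiff (Set.Iic_subset_Iic.2 (by linarith)) measurableSet_Iic.nullMeasurableSet
      (measure_ne_top _ _), expMeasure_Iic, expMeasure_Iic, if_pos hh, if_pos (by linarith),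
      ← ENNReal.ofReal_sub, ← ENNReal.ofReal_mul (Real.exp_pos _).le]
    · congr 1
      rw [neg_add, Real.exp_add]
      ring
    · have := Real.exp_le_one_iff.2 (neg_nonpos.2 hh)
      linarith
  · rw [Set.sdiff_eq_empty.2 (Set.Iic_subset_Iic.2 (by linarith)), measure_empty,
      ENNReal.ofReal_zero, mul_zero]

lemma noAtoms_expMeasure (a : ℝ) : expMeasure 1 {a} = 0 := by
  unfold expMeasure gammaMeasure
  exact withDensity_absolutelyContinuous _ _ (measure_singleton a)

end Exponential

/-! ### The law of the clock and coins of one edge -/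

section EdgeLaw

/-- The waiting times and the coins of one edge. -/
abbrev EdgeData : Type := (ℕ → ℝ) × (ℕ → Bool)

/-- The law of one fair coin. -/
noncomputable def coinLaw : Measure Bool := (PMF.uniformOfFintype Bool).toMeasure

instance isProbabilityMeasure_coinLaw : IsProbabilityMeasure coinLaw := by
  unfold coinLaw; infer_instance

/-- The law of the waiting times and the coins of one edge. -/
noncomputable def edgeLaw : Measure EdgeData :=
  (Measure.infinitePi fun _ : ℕ => expMeasure 1).prod (Measure.infinitePi fun _ : ℕ => coinLaw)

instance isProbabilityMeasure_edgeLaw : IsProbabilityMeasure edgeLaw := by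
  unfold edgeLaw; infer_instance

lemma siteLaw_eq : siteLaw = (AddCircle.haarAddCircle (T := 2)).prod edgeLaw := rfl

instance isProbabilityMeasure_siteLaw : IsProbabilityMeasure siteLaw := by
  rw [siteLaw_eq]; infer_instance

instance isProbabilityMeasure_driveLaw : IsProbabilityMeasure driveLaw := by
  unfold driveLaw; infer_instance

/-- Put one waiting time and one coin in front. -/
def consEdge (a : ℝ) (b : Bool) (x : EdgeData) : EdgeData := (consSeq a x.1, consSeq b x.2)

@[fun_prop]
lemma measurable_consEdge {β : Type*} [MeasurableSpace β] {f : β → ℝ} {g : β → Bool}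
    {x : β → EdgeData} (hf : Measurable f) (hg : Measurable g) (hx : Measurable x) :
    Measurable fun y => consEdge (f y) (g y) (x y) := by
  unfold consEdge; fun_prop

/-- Conditioning on the first waiting time and the first coin leaves an independent copy of the edge
data; the Markov property is proved by induction on this. -/
lemma lintegral_edgeLaw {F : EdgeData → ℝ≥0∞} (hF : Measurable F) :
    ∫⁻ x, F x ∂edgeLaw
      = ∫⁻ a, ∫⁻ b, ∫⁻ x, F (consEdge a b x) ∂edgeLaw ∂coinLaw ∂(expMeasure 1) := by
  unfold edgeLaw
  rw [lintegral_prod _ hF.aemeasurable]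
  conv_lhs => rw [← map_consSeq_infinitePi (expMeasure 1)]
  rw [lintegral_map (by fun_prop) (by fun_prop), lintegral_prod _ (by fun_prop)]
  refine lintegral_congr fun a => ?_
  have h1 : ∀ w : ℕ → ℝ, ∫⁻ c, F (consSeq a w, c) ∂(Measure.infinitePi fun _ : ℕ => coinLaw)
      = ∫⁻ b, ∫⁻ c, F (consSeq a w, consSeq b c)
        ∂(Measure.infinitePi fun _ : ℕ => coinLaw) ∂coinLaw := by
    intro w
    conv_lhs => rw [← map_consSeq_infinitePi coinLaw]
    rw [lintegral_map (by fun_prop) (by fun_prop), lintegral_prod _ (by fun_prop)]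
  simp only [h1]
  rw [lintegral_lintegral_swap]
  · refine lintegral_congr fun b => ?_
    rw [lintegral_prod _ (Measurable.aemeasurable (by fun_prop))]
    rfl
  · refine Measurable.aemeasurable ?_
    refine Measurable.lintegral_prod_right' (f := fun p : ((ℕ → ℝ) × Bool) × (ℕ → Bool) =>
      F (consSeq a p.1.1, consSeq p.1.2 p.2)) ?_
    fun_prop

lemma edgeLaw_apply {A : Set EdgeData} (hA : MeasurableSet A) :
    edgeLaw A
      = ∫⁻ a, ∫⁻ b, edgeLaw {x | consEdge a b x ∈ A} ∂coinLaw ∂(expMeasure 1) := by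
  rw [← lintegral_indicator_one hA, lintegral_edgeLaw (measurable_one.indicator hA)]
  refine lintegral_congr fun a => lintegral_congr fun b => ?_
  have hm : MeasurableSet {x | consEdge a b x ∈ A} :=
    (measurable_consEdge measurable_const measurable_const measurable_id) hA
  rw [← lintegral_indicator_one hm]
  rfl

end EdgeLaw

/-! ### Restarting a clock at a given time -/

section Shift

/-- The time of the ring number `k` for the waiting times `w`. -/
def arrival (w : ℕ → ℝ) (k : ℕ) : ℝ := ∑ i ∈ Finset.range (k + 1), w i

lemma ringTime_eq_arrival (y : Drive) (e : ℤ) (k : ℕ) :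
    ringTime y e k = arrival (y e).2.1 k := rfl

@[simp] lemma arrival_zero (w : ℕ → ℝ) : arrival w 0 = w 0 := by simp [arrival]

lemma arrival_succ (w : ℕ → ℝ) (k : ℕ) : arrival w (k + 1) = arrival w k + w (k + 1) :=
  Finset.sum_range_succ _ _

@[simp] lemma arrival_consSeq_succ (a : ℝ) (w : ℕ → ℝ) (k : ℕ) :
    arrival (consSeq a w) (k + 1) = a + arrival w k := by
  rw [arrival, Finset.sum_range_succ', add_comm]
  rfl

@[fun_prop]
lemma measurable_arrival (k : ℕ) : Measurable fun w => arrival w k := by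
  unfold arrival; fun_prop

/-- The ring number `k` is the first one after time `h`. -/
def IsFirstAfter (h : ℝ) (w : ℕ → ℝ) (k : ℕ) : Prop :=
  h < arrival w k ∧ ∀ i < k, arrival w i ≤ h

lemma IsFirstAfter.unique {h : ℝ} {w : ℕ → ℝ} {k l : ℕ} (hk : IsFirstAfter h w k)
    (hl : IsFirstAfter h w l) : k = l := by
  rcases lt_trichotomy k l with hkl | hkl | hkl
  · exact absurd (hl.2 k hkl) (not_le.2 hk.1)
  · exact hkl
  · exact absurd (hk.2 l hkl) (not_le.2 hl.1)

lemma isFirstAfter_zero {h : ℝ} {w : ℕ → ℝ} : IsFirstAfter h w 0 ↔ h < w 0 := by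
  simp [IsFirstAfter]

/-- Removing the first wait a lowers the ring number by one and turns the time h into h − a, which
drives the induction on the number of rings. -/
lemma isFirstAfter_consSeq_succ {h a : ℝ} {w : ℕ → ℝ} {k : ℕ} :
    IsFirstAfter h (consSeq a w) (k + 1) ↔ a ≤ h ∧ IsFirstAfter (h - a) w k := by
  simp only [IsFirstAfter, arrival_consSeq_succ, Nat.forall_lt_succ_left, arrival_zero,
    consSeq_zero, sub_lt_iff_lt_add', le_sub_iff_add_le']
  tauto

@[measurability]
lemma measurableSet_isFirstAfter (k : ℕ) :
    MeasurableSet {p : ℝ × (ℕ → ℝ) | IsFirstAfter p.1 p.2 k} := by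
  have h : ∀ i, Measurable fun p : ℝ × (ℕ → ℝ) => arrival p.2 i := fun i => by fun_prop
  have h1 : {p : ℝ × (ℕ → ℝ) | IsFirstAfter p.1 p.2 k}
      = {p | p.1 < arrival p.2 k} ∩ ⋂ i, ⋂ (_ : i < k), {p | arrival p.2 i ≤ p.1} := by
    ext p
    simp [IsFirstAfter]
  rw [h1]
  exact (measurableSet_lt measurable_fst (h k)).inter
    (MeasurableSet.iInter fun i => MeasurableSet.iInter fun _ =>
      measurableSet_le (h i) measurable_fst)

/-- The data of an edge seen from time `h`, if the next ring has number `k`. -/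
def restart (k : ℕ) (h : ℝ) (x : EdgeData) : EdgeData :=
  (consSeq (arrival x.1 k - h) (fun i => x.1 (k + 1 + i)), fun i => x.2 (k + i))

lemma measurable_restart (k : ℕ) : Measurable fun p : ℝ × EdgeData => restart k p.1 p.2 := by
  unfold restart; fun_prop

lemma restart_consEdge_zero (h a : ℝ) (b : Bool) (x : EdgeData) :
    restart 0 h (consEdge a b x) = consEdge (a - h) b x := by
  simp only [restart, consEdge, arrival_zero, consSeq_zero, zero_add]
  congr 2
  funext i
  rw [add_comm]
  rfl

lemma restart_consEdge_succ (k : ℕ) (h a : ℝ) (b : Bool) (x : EdgeData) :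
    restart (k + 1) h (consEdge a b x) = restart k (h - a) x := by
  simp only [restart, consEdge, arrival_consSeq_succ]
  congr 2
  · ring
  · funext i
    rw [show k + 1 + 1 + i = (k + 1 + i) + 1 by ring, consSeq_succ]
  · funext i
    rw [show k + 1 + i = (k + i) + 1 by ring, consSeq_succ]

instance : MeasurableSpace (Option Bool) := ⊤

instance : DiscreteMeasurableSpace (Option Bool) := ⟨fun _ => trivial⟩

/-- The coin of the first ring in `(0, h]`, if there is one. -/
noncomputable def obs (h : ℝ) (x : EdgeData) : Option Bool :=
  if h < x.1 0 then none else some (x.2 0)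

lemma obs_consEdge (h a : ℝ) (b : Bool) (x : EdgeData) :
    obs h (consEdge a b x) = if h < a then none else some b := rfl

lemma measurable_obs (h : ℝ) : Measurable (obs h) := by
  unfold obs
  refine Measurable.ite (measurableSet_lt measurable_const (by fun_prop)) measurable_const ?_
  exact (measurable_of_countable (some : Bool → Option Bool)).comp (by fun_prop)

lemma measurableSet_firstAfter_obs_restart (h : ℝ) (k : ℕ) (S : Set (Option Bool))
    {G : Set EdgeData} (hG : MeasurableSet G) :
    MeasurableSet {x : EdgeData | IsFirstAfter h x.1 k ∧ obs h x ∈ S ∧ restart k h x ∈ G} := by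
  refine MeasurableSet.inter ?_ (MeasurableSet.inter ?_ ?_)
  · exact (measurable_const.prodMk measurable_fst : Measurable fun x : EdgeData => (h, x.1))
      (measurableSet_isFirstAfter k)
  · exact measurable_obs h (DiscreteMeasurableSpace.forall_measurableSet S)
  · exact ((measurable_restart k).comp (measurable_const.prodMk measurable_id)) hG

/-- The Markov property of the clock of an edge, on the event that `k` rings take place. -/
lemma edgeLaw_firstAfter_obs_restart (k : ℕ) {h : ℝ} (hh : 0 ≤ h) (S : Set (Option Bool))
    {G : Set EdgeData} (hG : MeasurableSet G) :
    edgeLaw {x | IsFirstAfter h x.1 k ∧ obs h x ∈ S ∧ restart k h x ∈ G}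
      = edgeLaw {x | IsFirstAfter h x.1 k ∧ obs h x ∈ S} * edgeLaw G := by
  induction k generalizing h S with
  | zero =>
    by_cases hS : none ∈ S
    · have h1 : ∀ x : EdgeData, IsFirstAfter h x.1 0 ∧ obs h x ∈ S ↔ h < x.1 0 := fun x => by
        rw [isFirstAfter_zero, and_iff_left_iff_imp]
        intro hx
        rwa [obs, if_pos hx]
      have hmem : MeasurableSet {x : EdgeData | h < x.1 0} :=
        measurableSet_lt measurable_const (by fun_prop)
      have hm := measurableSet_firstAfter_obs_restart h 0 S hG
      simp only [← and_assoc, h1] at hm ⊢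
      set φ : ℝ → ℝ≥0∞ := fun a => ∫⁻ b, edgeLaw {x | consEdge a b x ∈ G} ∂coinLaw with hφ
      have hφm : Measurable φ := by
        refine Measurable.lintegral_prod_right' (f := fun p : ℝ × Bool =>
          edgeLaw {x | consEdge p.1 p.2 x ∈ G}) ?_
        have : MeasurableSet {q : (ℝ × Bool) × EdgeData | consEdge q.1.1 q.1.2 q.2 ∈ G} :=
          (by fun_prop : Measurable fun q : (ℝ × Bool) × EdgeData =>
            consEdge q.1.1 q.1.2 q.2) hG
        exact measurable_measure_prodMk_left this
      have e1 : edgeLaw {x | h < x.1 0 ∧ restart 0 h x ∈ G}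
          = ∫⁻ a, (Set.Ioi h).indicator (fun a => φ (a - h)) a ∂(expMeasure 1) := by
        rw [edgeLaw_apply hm]
        refine lintegral_congr fun a => ?_
        by_cases ha : h < a
        · rw [Set.indicator_of_mem (show a ∈ Set.Ioi h from ha)]
          refine lintegral_congr fun b => ?_
          congr 1
          ext x
          simp only [Set.mem_ofPred_eq, restart_consEdge_zero]
          simp [consEdge, ha]
        · rw [Set.indicator_of_notMem (show a ∉ Set.Ioi h from ha)]
          simp [consEdge, ha]
      have e2 : edgeLaw {x | h < x.1 0} = expMeasure 1 (Set.Ioi h) := by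
        rw [edgeLaw_apply hmem, ← lintegral_indicator_one measurableSet_Ioi]
        refine lintegral_congr fun a => ?_
        by_cases ha : h < a
        · rw [Set.indicator_of_mem (show a ∈ Set.Ioi h from ha)]
          simp only [consEdge, Set.mem_ofPred_eq, consSeq_zero, ha, Set.ofPred_true, measure_univ,
            lintegral_const, mul_one, Pi.one_apply]
        · rw [Set.indicator_of_notMem (show a ∉ Set.Ioi h from ha)]
          simp [consEdge, ha]
      rw [e1, e2, lintegral_indicator measurableSet_Ioi,
        ← lintegral_map hφm (by fun_prop : Measurable fun a : ℝ => a - h),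
        map_sub_restrict_expMeasure hh, lintegral_smul_measure, smul_eq_mul, edgeLaw_apply hG]
    · have h1 : ∀ x : EdgeData, ¬ (IsFirstAfter h x.1 0 ∧ obs h x ∈ S) := fun x hx => by
        rw [isFirstAfter_zero] at hx
        rw [obs, if_pos hx.1] at hx
        exact hS hx.2
      simp [← and_assoc, h1]
  | succ k ih =>
    have hm := measurableSet_firstAfter_obs_restart h (k + 1) S hG
    have hm' := measurableSet_firstAfter_obs_restart h (k + 1) S MeasurableSet.univ
    simp only [Set.mem_univ, and_true] at hm'
    rw [edgeLaw_apply hm, edgeLaw_apply hm', ← lintegral_mul_const']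
    swap
    · exact measure_ne_top _ _
    refine lintegral_congr fun a => ?_
    rw [← lintegral_mul_const' _ _ (measure_ne_top _ _)]
    refine lintegral_congr fun b => ?_
    simp only [Set.mem_ofPred_eq, restart_consEdge_succ, obs_consEdge]
    have hfst : ∀ x : EdgeData, (consEdge a b x).1 = consSeq a x.1 := fun _ => rfl
    simp only [hfst, isFirstAfter_consSeq_succ]
    by_cases ha : a ≤ h
    · by_cases hb : some b ∈ S
      · have := ih (h := h - a) (by linarith) Set.univ
        simp only [Set.mem_univ, true_and, and_true] at this
        simp only [ha, not_lt.2 ha, hb, true_and, if_false, and_true]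
        exact this
      · simp [ha, not_lt.2 ha, hb]
    · simp [ha]

end Shift

/-! ### Infinite products: recurrence and independence -/

section InfiniteProduct

/-- Missing the set at M distinct coordinates has probability (1 − ν A)^M, which tends to 0. -/
lemma ae_exists_mem_infinitePi {ι Z : Type*} [MeasurableSpace Z] (ν : Measure Z)
    [IsProbabilityMeasure ν] {i : ℕ → ι} (hi : Function.Injective i) {A : Set Z}
    (hA : MeasurableSet A) (hν : ν A ≠ 0) :
    ∀ᵐ x ∂(Measure.infinitePi fun _ : ι => ν), ∃ n, x (i n) ∈ A := by
  classical
  rw [ae_iff]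
  have h1 : ∀ M : ℕ, Measure.infinitePi (fun _ : ι => ν) {x | ¬ ∃ n, x (i n) ∈ A}
      ≤ ν Aᶜ ^ M := by
    intro M
    have h2 : {x : ι → Z | ¬ ∃ n, x (i n) ∈ A}
        ⊆ Set.pi ((Finset.range M).image i) fun _ => Aᶜ := by
      intro x hx j hj
      obtain ⟨n, -, rfl⟩ := Finset.mem_image.1 (Finset.mem_coe.1 hj)
      exact fun h => hx ⟨n, h⟩
    refine (measure_mono h2).trans_eq ?_
    rw [Measure.infinitePi_pi _ fun _ _ => hA.compl, Finset.prod_const,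
      Finset.card_image_of_injective _ hi, Finset.card_range]
  have h3 : ν Aᶜ < 1 := by
    rw [prob_compl_eq_one_sub hA]
    exact ENNReal.sub_lt_self ENNReal.one_ne_top one_ne_zero hν
  exact le_antisymm (ge_of_tendsto' (ENNReal.tendsto_pow_atTop_nhds_zero_of_lt_one h3) h1) zero_le

lemma iIndepFun_bool {Ω T : Type*} [MeasurableSpace Ω] [MeasurableSpace T] {P : Measure Ω}
    [IsProbabilityMeasure P] {X : Bool → Ω → T} (h : IndepFun (X false) (X true) P) :
    iIndepFun X P := by
  rw [iIndepFun_iff_measure_inter_preimage_eq_mul]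
  intro S sets hs
  have hS : S = ∅ ∨ S = {false} ∨ S = {true} ∨ S = {false, true} := by
    clear hs
    revert S
    decide
  rcases hS with rfl | rfl | rfl | rfl
  · simp
  · simp
  · simp
  · rw [Finset.prod_pair (by decide), ← h.measure_inter_preimage_eq_mul _ _ (hs _ (by simp))
      (hs _ (by simp))]
    congr 1
    ext
    simp

lemma comap_pi_le {Ω ι B : Type*} [MeasurableSpace B] (m : MeasurableSpace Ω) {f : Ω → ι → B}
    (h : ∀ e, Measurable fun ω => f ω e) : MeasurableSpace.comap f inferInstance ≤ m :=
  (measurable_pi_lambda _ h).comap_le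

/-- If two functions of a coordinate are independent, then so are the two fields which they
define on an infinite product. -/
lemma indepFun_infinitePi {ι Z A B : Type*} [MeasurableSpace Z] [MeasurableSpace A]
    [MeasurableSpace B] [Nonempty A] [Nonempty B] (ν : Measure Z) [IsProbabilityMeasure ν]
    {p : Z → A} {q : Z → B} (hp : Measurable p) (hq : Measurable q) (h : IndepFun p q ν) :
    IndepFun (fun (y : ι → Z) e => p (y e)) (fun (y : ι → Z) e => q (y e))
      (Measure.infinitePi fun _ : ι => ν) := by
  obtain ⟨a₀⟩ := ‹Nonempty A›
  obtain ⟨b₀⟩ := ‹Nonempty B›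
  -- Padding with constants gives both functions one codomain, so that they form a single
  -- independent family over ι × Bool, to be split by its second index.
  let f : Bool → Z → A × B := fun b z => if b then (a₀, q z) else (p z, b₀)
  have hf : ∀ b, Measurable (f b) := by
    rintro (_ | _)
    · exact hp.prodMk measurable_const
    · exact measurable_const.prodMk hq
  have h1 : iIndepFun (fun (pr : ι × Bool) (y : ι → Z) => f pr.2 (y pr.1))
      (Measure.infinitePi fun _ : ι => ν) := by
    refine iIndepFun_uncurry' (X := fun (e : ι) (b : Bool) (y : ι → Z) => f b (y e))
      (fun e b => (hf b).comp (measurable_pi_apply e)) ?_ fun e => ?_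
    · exact iIndepFun_infinitePi (P := fun _ : ι => ν) (X := fun _ z b => f b z)
        fun _ => measurable_pi_lambda _ hf
    · refine iIndepFun_bool ?_
      have h2 : IndepFun (f false) (f true) ν :=
        h.comp (φ := fun a => (a, b₀)) (ψ := fun b => (a₀, b)) (by fun_prop) (by fun_prop)
      have he := measurePreserving_eval_infinitePi (fun _ : ι => ν) e
      rw [indepFun_iff_measure_inter_preimage_eq_mul] at h2 ⊢
      intro s t hs ht
      have h3 := h2 s t hs ht
      rwa [← he.measure_preimage ((hf _ hs).inter (hf _ ht)).nullMeasurableSet,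
        ← he.measure_preimage (hf _ hs).nullMeasurableSet,
        ← he.measure_preimage (hf _ ht).nullMeasurableSet] at h3
  have h3 := indep_iSup_of_disjoint (S := {pr : ι × Bool | pr.2 = false})
    (T := {pr : ι × Bool | pr.2 = true})
    (fun pr => ((hf pr.2).comp (measurable_pi_apply pr.1)).comap_le) h1.iIndep
    (Set.disjoint_left.2 fun pr h1 h2 => by simp_all)
  rw [IndepFun_iff_Indep]
  refine indep_of_indep_of_le_left (indep_of_indep_of_le_right h3 ?_) ?_
  · refine comap_pi_le _ fun e => ?_
    have h4 : Measurable[⨆ pr ∈ {pr : ι × Bool | pr.2 = true},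
        MeasurableSpace.comap (fun y : ι → Z => f pr.2 (y pr.1)) inferInstance]
        fun y : ι → Z => f true (y e) :=
      (comap_measurable _).mono (le_iSup₂_of_le (e, true) rfl le_rfl) le_rfl
    exact measurable_snd.comp h4
  · refine comap_pi_le _ fun e => ?_
    have h4 : Measurable[⨆ pr ∈ {pr : ι × Bool | pr.2 = false},
        MeasurableSpace.comap (fun y : ι → Z => f pr.2 (y pr.1)) inferInstance]
        fun y : ι → Z => f false (y e) :=
      (comap_measurable _).mono (le_iSup₂_of_le (e, false) rfl le_rfl) le_rfl
    exact measurable_fst.comp h4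

end InfiniteProduct

/-! ### Almost sure regularity of a clock -/

section Regular

/-- Waiting times that are positive and whose sum is infinite. -/
def Regular (w : ℕ → ℝ) : Prop := (∀ i, 0 < w i) ∧ ∀ T : ℝ, ∃ k, T < arrival w k

lemma Regular.strictMono {w : ℕ → ℝ} (hw : Regular w) : StrictMono (arrival w) :=
  strictMono_nat_of_lt_succ fun k => by
    rw [arrival_succ]
    linarith [hw.1 (k + 1)]

lemma Regular.exists_isFirstAfter {w : ℕ → ℝ} (hw : Regular w) (h : ℝ) :
    ∃ k, IsFirstAfter h w k := by
  classical
  exact ⟨Nat.find (hw.2 h), Nat.find_spec (hw.2 h), fun i hi => not_lt.1 (Nat.find_min _ hi)⟩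

lemma ae_regular : ∀ᵐ x ∂edgeLaw, Regular x.1 := by
  have h1 : ∀ᵐ w ∂(Measure.infinitePi fun _ : ℕ => expMeasure 1), Regular w := by
    have hpos : ∀ᵐ w ∂(Measure.infinitePi fun _ : ℕ => expMeasure 1), ∀ i, 0 < w i := by
      rw [ae_all_iff]
      intro i
      have h2 : ∀ᵐ a ∂(Measure.infinitePi fun _ : ℕ => expMeasure 1).map (fun w => w i),
          0 < a := by
        rw [Measure.infinitePi_map_eval, ae_iff]
        simp only [not_lt]
        exact expMeasure_Iic_zero
      exact ae_of_ae_map (measurable_pi_apply i).aemeasurable h2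
    have hbig : ∀ᵐ w ∂(Measure.infinitePi fun _ : ℕ => expMeasure 1),
        ∀ n : ℕ, ∃ i, w (n + 1 + i) ∈ Set.Ioi (1 : ℝ) := by
      rw [ae_all_iff]
      intro n
      refine ae_exists_mem_infinitePi (expMeasure 1) (add_right_injective (n + 1))
        measurableSet_Ioi ?_
      rw [expMeasure_Ioi zero_le_one, Ne, ENNReal.ofReal_eq_zero, not_le]
      exact Real.exp_pos _
    filter_upwards [hpos, hbig] with w h1 h2
    have hmono : Monotone (arrival w) := monotone_nat_of_le_succ fun k => by
      rw [arrival_succ]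
      linarith [h1 (k + 1)]
    refine ⟨h1, fun T => ?_⟩
    have h3 : ∀ M : ℕ, ∃ k, (M : ℝ) < arrival w k := by
      intro M
      induction M with
      | zero => exact ⟨0, by simpa using h1 0⟩
      | succ M ih =>
        obtain ⟨k, hk⟩ := ih
        obtain ⟨i, hi⟩ := h2 k
        refine ⟨k + 1 + i, ?_⟩
        have h4 : arrival w (k + 1 + i) = arrival w (k + i) + w (k + 1 + i) := by
          rw [show k + 1 + i = (k + i) + 1 by ring, arrival_succ]
        have h5 := hmono (Nat.le_add_right k i)
        rw [h4]
        push_cast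
        linarith [Set.mem_Ioi.1 hi]
    obtain ⟨M, hM⟩ := exists_nat_gt T
    obtain ⟨k, hk⟩ := h3 M
    exact ⟨k, hM.trans hk⟩
  exact Measure.quasiMeasurePreserving_fst.ae h1

lemma arrival_restart (k : ℕ) (h : ℝ) (x : EdgeData) (i : ℕ) :
    arrival (restart k h x).1 i = arrival x.1 (k + i) - h := by
  induction i with
  | zero => simp [restart]
  | succ i ih =>
    rw [arrival_succ, ih, ← add_assoc, arrival_succ]
    simp only [restart, consSeq_succ]
    rw [show k + 1 + i = k + i + 1 by ring]
    ring

lemma Regular.restart {x : EdgeData} (hx : Regular x.1) {h : ℝ} {k : ℕ}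
    (hk : IsFirstAfter h x.1 k) : Regular (restart k h x).1 := by
  refine ⟨fun i => ?_, fun T => ?_⟩
  · cases i with
    | zero => simpa [Compass.restart] using hk.1
    | succ i => exact hx.1 _
  · obtain ⟨l, hl⟩ := hx.2 (T + h)
    refine ⟨l, ?_⟩
    rw [arrival_restart]
    have := hx.strictMono.monotone (Nat.le_add_left l k)
    linarith

end Regular

/-! ### Shifts of a clock, time cells and the Markov property -/

section Shift

/-- The number of the first ring after time `h`. -/
noncomputable def firstIndex (h : ℝ) (w : ℕ → ℝ) : ℕ := sInf {k | IsFirstAfter h w k}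

lemma IsFirstAfter.firstIndex_eq {h : ℝ} {w : ℕ → ℝ} {k : ℕ} (hk : IsFirstAfter h w k) :
    firstIndex h w = k :=
  (Nat.sInf_mem (s := {k | IsFirstAfter h w k}) ⟨k, hk⟩).unique hk

lemma measurable_firstIndex (h : ℝ) : Measurable (firstIndex h) := by
  have hm : ∀ k, MeasurableSet {w | IsFirstAfter h w k} := fun k =>
    (measurable_const.prodMk measurable_id : Measurable fun w : ℕ → ℝ => (h, w))
      (measurableSet_isFirstAfter k)
  refine measurable_to_countable' fun k => ?_
  -- Since `sInf ∅ = 0`, the fibre over 0 also contains the sequences with no first ring after h.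
  have h1 : firstIndex h ⁻¹' {k}
      = {w | IsFirstAfter h w k} ∪ ({w | k = 0} ∩ ⋂ l, {w | IsFirstAfter h w l}ᶜ) := by
    ext w
    simp only [Set.mem_preimage, Set.mem_singleton_iff, Set.mem_union, Set.mem_ofPred_eq,
      Set.mem_inter_iff, Set.mem_iInter, Set.mem_compl_iff]
    constructor
    · rintro rfl
      by_cases hw : ∃ l, IsFirstAfter h w l
      · exact Or.inl (Nat.sInf_mem (s := {k | IsFirstAfter h w k}) hw)
      · push Not at hw
        refine Or.inr ⟨?_, hw⟩
        rw [firstIndex, Nat.sInf_eq_zero]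
        right
        ext l
        simp [hw l]
    · rintro (hk | ⟨rfl, hk⟩)
      · exact hk.firstIndex_eq
      · rw [firstIndex, Nat.sInf_eq_zero]
        right
        ext l
        simp [hk l]
  rw [h1]
  exact (hm k).union ((MeasurableSet.const _).inter (MeasurableSet.iInter fun l => (hm l).compl))

/-- The data of an edge seen from time `h`. -/
noncomputable def shift (h : ℝ) (x : EdgeData) : EdgeData := restart (firstIndex h x.1) h x

lemma measurable_shift (h : ℝ) : Measurable (shift h) := by
  have h1 : Measurable fun p : ℕ × EdgeData => restart p.1 h p.2 :=
    measurable_from_prod_countable_right fun k =>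
      (measurable_restart k).comp (measurable_const.prodMk measurable_id)
  exact h1.comp (((measurable_firstIndex h).comp measurable_fst).prodMk measurable_id)

lemma Regular.shift {x : EdgeData} (hx : Regular x.1) (h : ℝ) : Regular (shift h x).1 := by
  obtain ⟨k, hk⟩ := hx.exists_isFirstAfter h
  rw [Compass.shift, hk.firstIndex_eq]
  exact hx.restart hk

lemma Regular.iterate_shift {x : EdgeData} (hx : Regular x.1) (h : ℝ) (j : ℕ) :
    Regular ((Compass.shift h)^[j] x).1 := by
  induction j with
  | zero => exact hx
  | succ j ih =>
    rw [Function.iterate_succ_apply']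
    exact ih.shift h

/-- The Markov property of the clock of an edge. -/
lemma edgeLaw_obs_shift {h : ℝ} (hh : 0 ≤ h) (S : Set (Option Bool)) {G : Set EdgeData}
    (hG : MeasurableSet G) :
    edgeLaw {x | obs h x ∈ S ∧ shift h x ∈ G} = edgeLaw {x | obs h x ∈ S} * edgeLaw G := by
  have key : ∀ G : Set EdgeData, MeasurableSet G →
      edgeLaw {x | obs h x ∈ S ∧ shift h x ∈ G}
        = ∑' k, edgeLaw {x | IsFirstAfter h x.1 k ∧ obs h x ∈ S} * edgeLaw G := by
    intro G hG
    have h1 : {x | obs h x ∈ S ∧ shift h x ∈ G} =ᵐ[edgeLaw]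
        ⋃ k, {x : EdgeData | IsFirstAfter h x.1 k ∧ obs h x ∈ S ∧ restart k h x ∈ G} := by
      filter_upwards [ae_regular] with x hx
      refine propext ⟨fun hxG => ?_, fun hxG => ?_⟩
      · obtain ⟨k, hk⟩ := hx.exists_isFirstAfter h
        refine Set.mem_iUnion.2 ⟨k, hk, hxG.1, ?_⟩
        have := hxG.2
        rwa [shift, hk.firstIndex_eq] at this
      · obtain ⟨k, hk, h2, h3⟩ := Set.mem_iUnion.1 hxG
        refine ⟨h2, ?_⟩
        rwa [shift, hk.firstIndex_eq]
    rw [measure_congr h1, measure_iUnion]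
    · exact tsum_congr fun k => edgeLaw_firstAfter_obs_restart k hh S hG
    · intro k l hkl
      exact Set.disjoint_left.2 fun x hk hl => hkl (hk.1.unique hl.1)
    · exact fun k => measurableSet_firstAfter_obs_restart h k S hG
  have h2 := key Set.univ MeasurableSet.univ
  simp only [Set.mem_univ, and_true, measure_univ, mul_one] at h2
  rw [key G hG, ENNReal.tsum_mul_right, h2]

/-- The coin of the first ring in `(j h, (j + 1) h]`, if there is one. -/
noncomputable def cell (h : ℝ) (j : ℕ) (x : EdgeData) : Option Bool := obs h ((shift h)^[j] x)

lemma cell_zero (h : ℝ) (x : EdgeData) : cell h 0 x = obs h x := rfl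

lemma cell_add (h : ℝ) (j J : ℕ) (x : EdgeData) :
    cell h (j + J) x = cell h j ((shift h)^[J] x) := by
  rw [cell, Function.iterate_add_apply]
  rfl

lemma measurable_cell (h : ℝ) (j : ℕ) : Measurable (cell h j) :=
  (measurable_obs h).comp ((measurable_shift h).iterate j)

/-- Iterating the Markov property: the first J cells are i.i.d. and independent of the shifted data,
which again has the law of an edge. -/
lemma edgeLaw_cell_shift {h : ℝ} (hh : 0 ≤ h) (J : ℕ) (s : ℕ → Set (Option Bool))
    {G : Set EdgeData} (hG : MeasurableSet G) :
    edgeLaw {x | (∀ i < J, cell h i x ∈ s i) ∧ (shift h)^[J] x ∈ G}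
      = (∏ i ∈ Finset.range J, edgeLaw {x | obs h x ∈ s i}) * edgeLaw G := by
  induction J generalizing s with
  | zero => simp
  | succ J ih =>
    have hm : MeasurableSet {x | (∀ i < J, cell h i x ∈ s (i + 1)) ∧ (shift h)^[J] x ∈ G} := by
      refine MeasurableSet.inter ?_ (((measurable_shift h).iterate J) hG)
      have : {x | ∀ i < J, cell h i x ∈ s (i + 1)}
          = ⋂ i, ⋂ (_ : i < J), cell h i ⁻¹' s (i + 1) := by
        ext x
        simp
      change MeasurableSet {x | ∀ i < J, cell h i x ∈ s (i + 1)}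
      rw [this]
      exact MeasurableSet.iInter fun i => MeasurableSet.iInter fun _ =>
        measurable_cell h i (DiscreteMeasurableSpace.forall_measurableSet _)
    have h1 : {x | (∀ i < J + 1, cell h i x ∈ s i) ∧ (shift h)^[J + 1] x ∈ G}
        = {x | obs h x ∈ s 0 ∧ shift h x ∈
          {x | (∀ i < J, cell h i x ∈ s (i + 1)) ∧ (shift h)^[J] x ∈ G}} := by
      ext x
      simp only [Set.mem_ofPred_eq, Nat.forall_lt_succ_left, Function.iterate_succ_apply,
        cell_zero, and_assoc]
      rfl
    rw [h1, edgeLaw_obs_shift hh _ hm, ih fun i => s (i + 1), Finset.prod_range_succ', mul_assoc,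
      mul_left_comm]

lemma edgeLaw_iterate_shift {h : ℝ} (hh : 0 ≤ h) (J : ℕ) {G : Set EdgeData}
    (hG : MeasurableSet G) : edgeLaw ((shift h)^[J] ⁻¹' G) = edgeLaw G := by
  have := edgeLaw_cell_shift hh J (fun _ => Set.univ) hG
  simp only [Set.mem_univ, implies_true, true_and, Set.ofPred_true, measure_univ,
    Finset.prod_const_one, one_mul] at this
  exact this

lemma indepFun_cell_shift {h : ℝ} (hh : 0 ≤ h) (J : ℕ) :
    IndepFun (fun x (i : Fin J) => cell h i x) ((shift h)^[J]) edgeLaw := by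
  have hf : Measurable fun x (i : Fin J) => cell h i x :=
    measurable_pi_lambda _ fun i => measurable_cell h i
  have hs := (measurable_shift h).iterate J
  rw [indepFun_iff_measure_inter_preimage_eq_mul]
  intro A G hA hG
  -- The cells take finitely many values, so it suffices to compare the two measures on singletons.
  have h1 : (edgeLaw.restrict ((shift h)^[J] ⁻¹' G)).map (fun x (i : Fin J) => cell h i x)
      = edgeLaw ((shift h)^[J] ⁻¹' G) • edgeLaw.map (fun x (i : Fin J) => cell h i x) := by
    refine Measure.ext_of_singleton fun a => ?_
    have hset : ∀ x, x ∈ (fun x (i : Fin J) => cell h i x) ⁻¹' {a} ↔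
        ∀ i < J, cell h i x ∈ {o | ∀ hi : i < J, o = a ⟨i, hi⟩} := by
      intro x
      simp only [Set.mem_preimage, Set.mem_singleton_iff, funext_iff, Set.mem_ofPred_eq,
        Fin.forall_iff]
      exact forall_congr' fun i => ⟨fun h1 h2 _ => h1 h2, fun h1 h2 => h1 h2 h2⟩
    rw [Measure.map_apply hf (measurableSet_singleton a),
      Measure.restrict_apply (hf (measurableSet_singleton a)), Measure.smul_apply, smul_eq_mul,
      Measure.map_apply hf (measurableSet_singleton a), edgeLaw_iterate_shift hh J hG, mul_comm]
    have e1 := edgeLaw_cell_shift hh J (fun i => {o | ∀ hi : i < J, o = a ⟨i, hi⟩}) hG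
    have e2 := edgeLaw_cell_shift hh J (fun i => {o | ∀ hi : i < J, o = a ⟨i, hi⟩})
      MeasurableSet.univ
    simp only [← hset, Set.mem_univ, and_true, measure_univ, mul_one] at e1 e2
    rw [← e2] at e1
    exact e1
  have h2 := congrArg (fun m => m A) h1
  simp only [Measure.smul_apply, smul_eq_mul] at h2
  rw [Measure.map_apply hf hA, Measure.restrict_apply (hf hA), Measure.map_apply hf hA] at h2
  rw [h2, mul_comm]

end Shift

/-! ### Cells in terms of the original arrival times -/

section Cells

/-- Shifting j times by h amounts to one restart at time jh; this translates statements on cells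
into statements on rings. -/
lemma Regular.exists_iterate_shift {x : EdgeData} (hx : Regular x.1) {h : ℝ} (hh : 0 ≤ h) (j : ℕ) :
    ∃ K, IsFirstAfter (j * h) x.1 K ∧
      (∀ i, arrival ((Compass.shift h)^[j] x).1 i = arrival x.1 (K + i) - j * h) ∧
      ∀ i, ((Compass.shift h)^[j] x).2 i = x.2 (K + i) := by
  induction j with
  | zero =>
    refine ⟨0, ?_, fun i => by simp, fun i => by simp⟩
    rw [isFirstAfter_zero]
    simpa using hx.1 0
  | succ j ih =>
    obtain ⟨K, hK, h1, h2⟩ := ih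
    obtain ⟨k, hk⟩ := (hx.iterate_shift h j).exists_isFirstAfter h
    have hj : ((j + 1 : ℕ) : ℝ) * h = j * h + h := by push_cast; ring
    refine ⟨K + k, ⟨?_, fun i hi => ?_⟩, fun i => ?_, fun i => ?_⟩
    · have := hk.1
      rw [h1] at this
      rw [hj]
      linarith
    · rw [hj]
      by_cases hiK : i < K
      · linarith [hK.2 i hiK]
      · obtain ⟨l, rfl⟩ := Nat.exists_eq_add_of_le (not_lt.1 hiK)
        have := hk.2 l (by omega)
        rw [h1] at this
        linarith
    · rw [Function.iterate_succ_apply', Compass.shift, hk.firstIndex_eq, arrival_restart, h1, hj,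
        add_assoc]
      ring
    · rw [Function.iterate_succ_apply', Compass.shift, hk.firstIndex_eq]
      simp only [Compass.restart]
      rw [h2, add_assoc]

lemma Regular.cell_eq_none_iff {x : EdgeData} (hx : Regular x.1) {h : ℝ} (hh : 0 ≤ h) (j : ℕ) :
    cell h j x = none ↔ ∀ k, ¬ (j * h < arrival x.1 k ∧ arrival x.1 k ≤ (j + 1) * h) := by
  obtain ⟨K, hK, h1, -⟩ := hx.exists_iterate_shift hh j
  have h3 := h1 0
  rw [arrival_zero, add_zero] at h3
  rw [cell, obs, h3]
  constructor
  · intro h4 k hk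
    split_ifs at h4 with h5
    have h6 : k < K := hx.strictMono.lt_iff_lt.1 (by linarith)
    linarith [hK.2 k h6]
  · intro h4
    have h5 := h4 K
    rw [if_pos]
    by_contra h6
    exact h5 ⟨hK.1, by linarith⟩

lemma Regular.exists_of_cell_eq_some {x : EdgeData} (hx : Regular x.1) {h : ℝ} (hh : 0 ≤ h) {j : ℕ}
    {c : Bool} (hc : cell h j x = some c) :
    ∃ k, (j * h < arrival x.1 k ∧ arrival x.1 k ≤ (j + 1) * h) ∧ x.2 k = c := by
  obtain ⟨K, hK, h1, h2⟩ := hx.exists_iterate_shift hh j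
  have h3 := h1 0
  rw [arrival_zero, add_zero] at h3
  rw [cell, obs, h3] at hc
  split_ifs at hc with h5
  refine ⟨K, ⟨hK.1, by linarith⟩, ?_⟩
  have := h2 0
  rw [add_zero] at this
  rw [← this]
  exact Option.some.inj hc

end Cells

/-! ### The time discretization and its agreement with the model -/

section Path

/-- The iterates of the automaton, from the configuration `ξ`, with the rings `b`. -/
noncomputable def traj (μ : ℝ) (ξ : ℤ → Opinion) (b : ℕ → ℤ → Option Bool) : ℕ → ℤ → Opinion
  | 0 => ξ
  | j + 1 => step μ (b j) (traj μ ξ b j)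

/-- The time discretization of the compass model with mesh `h`. -/
noncomputable def approx (μ h : ℝ) (y : Drive) : ℕ → ℤ → Opinion :=
  traj μ (fun v => (y v).1) fun j e => cell h j (y e).2

lemma approx_zero (μ h : ℝ) (y : Drive) (v : ℤ) : approx μ h y 0 v = (y v).1 := rfl

lemma approx_succ (μ h : ℝ) (y : Drive) (j : ℕ) :
    approx μ h y (j + 1) = step μ (fun e => cell h j (y e).2) (approx μ h y j) := rfl

/-- The clocks for which the graphical construction is well posed. -/
structure WellPosed (y : Drive) : Prop where
  regular : ∀ e, Regular (y e).2.1
  ringTime_ne : ∀ e e', e ≠ e' → ∀ k k', ringTime y e k ≠ ringTime y e' k'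
  exists_quiet_right : ∀ T n : ℕ, ∃ i : ℕ, (T : ℝ) < ringTime y (n + i) 0
  exists_quiet_left : ∀ T n : ℕ, ∃ i : ℕ, (T : ℝ) < ringTime y (-n - i) 0

variable {μ : ℝ} {y : Drive} {η : ℝ≥0 → ℤ → Opinion}

/-- In a block of edges with at most one ring in a time cell, and none at its ends, the automaton
makes the same moves as the compass model. -/
lemma IsCompassPath.step_eq (hη : IsCompassPath μ y η) (hy : WellPosed y) {h : ℝ} (hh : 0 ≤ h)
    {j : ℕ} {s s' : ℝ≥0} (hs : (s : ℝ) = j * h) (hs' : (s' : ℝ) = (j + 1) * h) {e f : ℤ}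
    (huniq : ∀ e₁ k₁ e₂ k₂, e ≤ e₁ → e₁ ≤ f → e ≤ e₂ → e₂ ≤ f →
      (s : ℝ) < ringTime y e₁ k₁ → ringTime y e₁ k₁ ≤ s' →
      (s : ℝ) < ringTime y e₂ k₂ → ringTime y e₂ k₂ ≤ s' → e₁ = e₂ ∧ k₁ = k₂)
    (he : ∀ k, ¬ ((s : ℝ) < ringTime y e k ∧ ringTime y e k ≤ s'))
    (hf : ∀ k, ¬ ((s : ℝ) < ringTime y f k ∧ ringTime y f k ≤ s'))
    {ξ : ℤ → Opinion} (hξ : ∀ v, e < v → v ≤ f → ξ v = η s v) {v : ℤ} (hv : e < v) (hv' : v ≤ f) :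
    step μ (fun e => cell h j (y e).2) ξ v = η s' v := by
  have hss : s ≤ s' := by
    rw [← NNReal.coe_le_coe, hs, hs']
    nlinarith
  have hnone : ∀ e, cell h j (y e).2 = none ↔
      ∀ k, ¬ ((s : ℝ) < ringTime y e k ∧ ringTime y e k ≤ s') := fun e => by
    rw [(hy.regular e).cell_eq_none_iff hh, hs, hs']
    rfl
  have hsome : ∀ e c, cell h j (y e).2 = some c →
      ∃ k, ((s : ℝ) < ringTime y e k ∧ ringTime y e k ≤ s') ∧ (y e).2.2 k = c := fun e c hc => by
    rw [hs, hs']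
    exact (hy.regular e).exists_of_cell_eq_some hh hc
  -- the effect of a ring inside the block
  have hring : ∀ g c, e ≤ g → g ≤ f → cell h j (y g).2 = some c →
      e < g ∧ g < f ∧ Active (fun e => cell h j (y e).2) g ∧
      η s' g = updateLeft μ c (η s g) (η s (g + 1)) ∧
      η s' (g + 1) = updateRight μ c (η s g) (η s (g + 1)) := by
    intro g c hg1 hg2 hc
    obtain ⟨k, ⟨hk1, hk2⟩, hk3⟩ := hsome g c hc
    have hge : e < g := lt_of_le_of_ne hg1 fun hge => he k (hge ▸ ⟨hk1, hk2⟩)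
    have hgf : g < f := lt_of_le_of_ne hg2 fun hgf => hf k (hgf ▸ ⟨hk1, hk2⟩)
    have hu : ∀ e' k', (e' = g - 1 ∨ e' = g ∨ e' = g + 1) → (s : ℝ) < ringTime y e' k' →
        ringTime y e' k' ≤ s' → e' = g ∧ k' = k := fun e' k' h1 h2 h3 =>
      huniq e' k' g k (by omega) (by omega) hg1 hg2 h2 h3 hk1 hk2
    have hτ0 : 0 ≤ ringTime y g k := s.2.trans hk1.le
    set τ : ℝ≥0 := ⟨ringTime y g k, hτ0⟩ with hτ
    have hτc : (τ : ℝ) = ringTime y g k := rfl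
    have hjump := hη.jump g k s τ (by rw [← NNReal.coe_lt_coe, hτc]; exact hk1) rfl
      fun e' k' h1 h2 => hu e' k' h1 h2.1 (h2.2.trans (by rw [hτc]; exact hk2))
    have hτs : τ ≤ s' := by rw [← NNReal.coe_le_coe, hτc]; exact hk2
    -- The ring at τ is the only one nearby in the cell, so the opinions produced at τ persist to
    -- the end of the cell.
    have hlate : ∀ e' k', (e' = g - 1 ∨ e' = g ∨ e' = g + 1) →
        ¬ ((τ : ℝ) < ringTime y e' k' ∧ ringTime y e' k' ≤ s') := by
      rintro e' k' h1 ⟨h2, h3⟩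
      obtain ⟨rfl, rfl⟩ := hu e' k' h1 (by rw [hτc] at h2; linarith) h3
      exact lt_irrefl _ h2
    refine ⟨hge, hgf, ⟨by simp [hc], (hnone _).2 fun k' hk' => ?_,
      (hnone _).2 fun k' hk' => ?_⟩, ?_, ?_⟩
    · have := (hu (g - 1) k' (by simp) hk'.1 hk'.2).1
      omega
    · have := (hu (g + 1) k' (by simp) hk'.1 hk'.2).1
      omega
    · rw [hη.const g τ s' hτs fun e' k' h1 => hlate e' k' (by omega), hjump.1, hk3]
    · rw [hη.const (g + 1) τ s' hτs fun e' k' h1 => hlate e' k' (by omega), hjump.2, hk3]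
  rcases hcv : cell h j (y v).2 with _ | c
  · rcases hcv' : cell h j (y (v - 1)).2 with _ | c
    · have h1 : ¬ Active (fun e => cell h j (y e).2) v := fun h => h.1 hcv
      have h2 : ¬ Active (fun e => cell h j (y e).2) (v - 1) := fun h => h.1 hcv'
      rw [step, if_neg h1, if_neg h2, hξ v hv hv', hη.const v s s' hss]
      rintro e' k' (rfl | rfl)
      · exact (hnone _).1 hcv' k'
      · exact (hnone _).1 hcv k'
    · obtain ⟨h1, h2, h3, -, h4⟩ := hring (v - 1) c (by omega) (by omega) hcv'
      have h5 : ¬ Active (fun e => cell h j (y e).2) v := fun h => h.1 hcv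
      rw [sub_add_cancel] at h4
      rw [step, if_neg h5, if_pos h3, hξ v hv hv', hξ (v - 1) h1 (by omega), h4, hcv']
      rfl
  · obtain ⟨h1, h2, h3, h4, -⟩ := hring v c hv.le hv' hcv
    rw [step, if_pos h3, hξ v hv hv', hξ (v + 1) (by omega) (by omega), h4, hcv]
    rfl

/-- The time discretizations with mesh `1 / m` converge to the compass model. -/
lemma IsCompassPath.eventually_approx_eq (hη : IsCompassPath μ y η) (hy : WellPosed y) (t : ℝ≥0)
    (v : ℤ) : ∀ᶠ m : ℕ in atTop, approx μ (1 / m) y ⌈t * m⌉₊ v = η t v := by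
  -- The last cell overshoots t by less than the mesh, which is at most 1. Edges that are silent up
  -- to time T on both sides of v cut out a finite block that evolves autonomously.
  obtain ⟨T, hT⟩ := exists_nat_ge ((t : ℝ) + 1)
  obtain ⟨i, hi⟩ := hy.exists_quiet_left T (v.natAbs + 1)
  obtain ⟨i', hi'⟩ := hy.exists_quiet_right T v.natAbs
  set e : ℤ := -((v.natAbs + 1 : ℕ) : ℤ) - i with he
  set f : ℤ := (v.natAbs : ℤ) + i' with hf
  have hev : e < v := by omega
  have hvf : v ≤ f := by omega
  have hquiet : ∀ e', (T : ℝ) < ringTime y e' 0 → ∀ k, (T : ℝ) < ringTime y e' k :=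
    fun e' h k => h.trans_le ((hy.regular e').strictMono.monotone (Nat.zero_le k))
  set S : Set (ℤ × ℕ) := {p | e ≤ p.1 ∧ p.1 ≤ f ∧ ringTime y p.1 p.2 ≤ T} with hS
  have hSfin : S.Finite := by
    have h1 : S ⊆ ⋃ e' ∈ Set.Icc e f, (fun k => (e', k)) '' {k | ringTime y e' k ≤ T} := by
      rintro ⟨e', k⟩ ⟨h1, h2, h3⟩
      exact Set.mem_biUnion (Set.mem_Icc.2 ⟨h1, h2⟩) ⟨k, h3, rfl⟩
    refine ((Set.finite_Icc e f).biUnion fun e' _ => Set.Finite.image _ ?_).subset h1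
    obtain ⟨K, hK⟩ := (hy.regular e').2 T
    refine (Set.finite_Iio K).subset fun k hk => ?_
    exact (hy.regular e').strictMono.lt_iff_lt.1 (lt_of_le_of_lt hk hK)
  have hlim := tendsto_one_div_atTop_nhds_zero_nat (𝕜 := ℝ)
  -- The finitely many ring times of the block are distinct, so for a small mesh no cell contains
  -- two of them.
  have hsep : ∀ᶠ m : ℕ in atTop, ∀ p ∈ S, ∀ q ∈ S, p ≠ q →
      1 / (m : ℝ) < |ringTime y p.1 p.2 - ringTime y q.1 q.2| := by
    rw [Filter.eventually_all_finite hSfin]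
    intro p _
    rw [Filter.eventually_all_finite hSfin]
    intro q _
    by_cases hpq : p = q
    · exact Filter.Eventually.of_forall fun m h => absurd hpq h
    · have h1 : 0 < |ringTime y p.1 p.2 - ringTime y q.1 q.2| := by
        rw [abs_pos, sub_ne_zero]
        by_cases h2 : p.1 = q.1
        · intro h3
          rw [h2] at h3
          exact hpq (Prod.ext h2 ((hy.regular q.1).strictMono.injective h3))
        · exact hy.ringTime_ne _ _ h2 _ _
      filter_upwards [hlim.eventually_lt_const h1] with m hm _ using hm
  -- For a small mesh, nothing rings in the block between t and the end of its cell.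
  have hsep' : ∀ᶠ m : ℕ in atTop, ∀ p ∈ S, (t : ℝ) < ringTime y p.1 p.2 →
      1 / (m : ℝ) < ringTime y p.1 p.2 - t := by
    rw [Filter.eventually_all_finite hSfin]
    intro p _
    by_cases hp : (t : ℝ) < ringTime y p.1 p.2
    · filter_upwards [hlim.eventually_lt_const (sub_pos.2 hp)] with m hm _ using hm
    · exact Filter.Eventually.of_forall fun m h => absurd h hp
  filter_upwards [hsep, hsep', eventually_ge_atTop 1] with m hm hm' hm1
  have hm0 : (0 : ℝ) < m := by exact_mod_cast hm1
  have hmle : 1 / (m : ℝ) ≤ 1 := by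
    rw [div_le_one hm0]
    exact_mod_cast hm1
  have hmpos : 0 < 1 / (m : ℝ) := by positivity
  have hceil : (⌈t * m⌉₊ : ℝ) < t * m + 1 := by
    have := Nat.ceil_lt_add_one (a := t * (m : ℝ≥0)) (zero_le)
    exact_mod_cast this
  have hceil' : (t : ℝ) * m ≤ ⌈t * m⌉₊ := by
    have := Nat.le_ceil (t * (m : ℝ≥0))
    exact_mod_cast this
  have htime : ∀ j : ℕ, j ≤ ⌈t * m⌉₊ → (j : ℝ) * (1 / m) < t + 1 / m := by
    intro j hj
    have h1 : (j : ℝ) ≤ ⌈t * m⌉₊ := by exact_mod_cast hj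
    rw [mul_one_div, ← sub_pos]
    have h2 : (t : ℝ) + 1 / m - j / m = (t * m + 1 - j) / m := by field_simp
    rw [h2]
    exact div_pos (by linarith) hm0
  have hcoe : ∀ j : ℕ, (((j : ℝ≥0) / (m : ℝ≥0) : ℝ≥0) : ℝ) = j * (1 / m) := by
    intro j
    push_cast
    ring
  have hind : ∀ j : ℕ, j ≤ ⌈t * m⌉₊ → ∀ u, e < u → u ≤ f →
      approx μ (1 / m) y j u = η ((j : ℝ≥0) / (m : ℝ≥0)) u := by
    intro j
    induction j with
    | zero =>
      intro _ u _ _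
      rw [Nat.cast_zero, zero_div, hη.initial, approx_zero]
    | succ j ih =>
      intro hj u hu hu'
      have hs' := hcoe (j + 1)
      have hT' : ((((j + 1 : ℕ) : ℝ≥0) / (m : ℝ≥0) : ℝ≥0) : ℝ) ≤ T := by
        rw [hs']
        linarith [htime (j + 1) hj]
      have hquiet' : ∀ e', (T : ℝ) < ringTime y e' 0 → ∀ k,
          ¬ ((((j : ℝ≥0) / (m : ℝ≥0) : ℝ≥0) : ℝ) < ringTime y e' k ∧
            ringTime y e' k ≤ (((j + 1 : ℕ) : ℝ≥0) / (m : ℝ≥0) : ℝ≥0)) :=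
        fun e' h k hk => absurd (hk.2.trans hT') (not_le.2 (hquiet e' h k))
      rw [approx_succ]
      refine hη.step_eq hy hmpos.le (hcoe j) (by rw [hs']; push_cast; ring) ?_
        (hquiet' e hi) (hquiet' f hi') (fun w hw hw' => ih (by omega) w hw hw') hu hu'
      intro e₁ k₁ e₂ k₂ h1 h2 h3 h4 h5 h6 h7 h8
      by_contra hne
      have hne' : ((e₁, k₁) : ℤ × ℕ) ≠ (e₂, k₂) := fun h =>
        hne ⟨congrArg Prod.fst h, congrArg Prod.snd h⟩
      have h9 := hm (e₁, k₁) ⟨h1, h2, h6.trans hT'⟩ (e₂, k₂) ⟨h3, h4, h8.trans hT'⟩ hne'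
      rw [hcoe] at h5 h7
      rw [hs'] at h6 h8
      push_cast at h6 h8
      have h10 : ((j : ℝ) + 1) * (1 / m) = j * (1 / m) + 1 / m := by ring
      rw [h10] at h6 h8
      exact absurd h9 (not_lt.2 (abs_le.2 ⟨by simp only; linarith, by simp only; linarith⟩))
  rw [hind _ le_rfl v hev hvf]
  refine hη.const v t _ ?_ ?_
  · rw [← NNReal.coe_le_coe, hcoe, mul_one_div, le_div_iff₀ hm0]
    exact hceil'
  · rintro e' k' he' ⟨h1, h2⟩
    rw [hcoe] at h2
    have h3 := htime _ le_rfl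
    have h4 : ringTime y e' k' ≤ T := by linarith
    have hin : e ≤ e' ∧ e' ≤ f := by omega
    have h5 := hm' (e', k') ⟨hin.1, hin.2, h4⟩ h1
    simp only at h5
    linarith

end Path

/-! ### Almost sure well-posedness of the clocks -/

section AlmostSure

lemma measurePreserving_waits :
    MeasurePreserving (fun z : SiteData => z.2.1) siteLaw
      (Measure.infinitePi fun _ : ℕ => expMeasure 1) :=
  measurePreserving_fst.comp measurePreserving_snd

lemma measurePreserving_edgeData :
    MeasurePreserving (fun z : SiteData => z.2) siteLaw edgeLaw :=
  measurePreserving_snd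

lemma measurePreserving_site (e : ℤ) :
    MeasurePreserving (fun y : Drive => y e) driveLaw siteLaw :=
  measurePreserving_eval_infinitePi (fun _ : ℤ => siteLaw) e

/-- Given all later waits, the arrival time is a translate of the first wait, whose law has no
atoms. -/
lemma infinitePi_arrival_eq (k : ℕ) (c : ℝ) :
    Measure.infinitePi (fun _ : ℕ => expMeasure 1) {w | arrival w k = c} = 0 := by
  have hm : MeasurableSet {w | arrival w k = c} :=
    measurable_arrival k (measurableSet_singleton c)
  rw [← map_consSeq_infinitePi (expMeasure 1), Measure.map_apply (by fun_prop) hm,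
    Measure.prod_apply_symm ((by fun_prop : Measurable fun p : ℝ × (ℕ → ℝ) =>
      consSeq p.1 p.2) hm)]
  refine (lintegral_congr fun w => ?_).trans lintegral_zero
  cases k with
  | zero =>
    refine measure_mono_null (fun a ha => ?_) (noAtoms_expMeasure c)
    simpa using ha
  | succ k =>
    refine measure_mono_null (fun a ha => ?_) (noAtoms_expMeasure (c - arrival w k))
    simp only [Set.mem_preimage, Set.mem_ofPred_eq, arrival_consSeq_succ] at ha
    rw [Set.mem_singleton_iff]
    linarith

lemma ae_ringTime_ne {e e' : ℤ} (he : e ≠ e') (k k' : ℕ) :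
    ∀ᵐ y ∂driveLaw, ringTime y e k ≠ ringTime y e' k' := by
  have hm : MeasurableSet {p : SiteData × SiteData | arrival p.1.2.1 k = arrival p.2.2.1 k'} :=
    measurableSet_eq_fun (by fun_prop) (by fun_prop)
  have h1 : ∀ᵐ p ∂(siteLaw.prod siteLaw), arrival p.1.2.1 k ≠ arrival p.2.2.1 k' := by
    rw [ae_iff]
    simp only [not_not]
    rw [Measure.measure_prod_null hm]
    refine Eventually.of_forall fun z => ?_
    change siteLaw (Prod.mk z ⁻¹' _) = 0
    have h2 : Prod.mk z ⁻¹' {p : SiteData × SiteData | arrival p.1.2.1 k = arrival p.2.2.1 k'}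
        = (fun z : SiteData => z.2.1) ⁻¹' {w | arrival w k' = arrival z.2.1 k} := by
      ext z'
      exact eq_comm
    have h3 : MeasurableSet {w | arrival w k' = arrival z.2.1 k} :=
      measurable_arrival k' (measurableSet_singleton _)
    rw [h2, measurePreserving_waits.measure_preimage h3.nullMeasurableSet]
    exact infinitePi_arrival_eq _ _
  rw [← Measure.infinitePi_map_eval_prod (P := fun _ : ℤ => siteLaw) he] at h1
  exact ae_of_ae_map (f := fun y : Drive => (y e, y e')) (by fun_prop) h1

lemma siteLaw_quiet (T : ℕ) : siteLaw {z | (T : ℝ) < z.2.1 0} ≠ 0 := by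
  have hm : MeasurableSet {w : ℕ → ℝ | (T : ℝ) < w 0} :=
    measurableSet_lt measurable_const (by fun_prop)
  have h1 : siteLaw {z | (T : ℝ) < z.2.1 0} = expMeasure 1 (Set.Ioi (T : ℝ)) := by
    rw [← (measurePreserving_eval_infinitePi (fun _ : ℕ => expMeasure 1) 0).measure_preimage
      measurableSet_Ioi.nullMeasurableSet]
    exact measurePreserving_waits.measure_preimage hm.nullMeasurableSet
  rw [h1, expMeasure_Ioi (Nat.cast_nonneg T), Ne, ENNReal.ofReal_eq_zero, not_le]
  exact Real.exp_pos _

lemma ae_wellPosed : ∀ᵐ y ∂driveLaw, WellPosed y := by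
  have h1 : ∀ᵐ y ∂driveLaw, ∀ e, Regular (y e).2.1 := by
    rw [ae_all_iff]
    intro e
    exact (measurePreserving_edgeData.comp (measurePreserving_site e)).quasiMeasurePreserving.ae
      ae_regular
  have h2 : ∀ᵐ y ∂driveLaw, ∀ e e' : ℤ, e ≠ e' → ∀ k k', ringTime y e k ≠ ringTime y e' k' := by
    simp only [ae_all_iff, eventually_imp_distrib_left]
    exact fun e e' he k k' => ae_ringTime_ne he k k'
  have hm : ∀ T : ℕ, MeasurableSet {z : SiteData | (T : ℝ) < z.2.1 0} := fun T =>
    measurableSet_lt measurable_const (by fun_prop)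
  have h3 : ∀ᵐ y ∂driveLaw, ∀ T n : ℕ, ∃ i : ℕ, (T : ℝ) < ringTime y (n + i) 0 := by
    simp only [ae_all_iff]
    intro T n
    have := ae_exists_mem_infinitePi (ι := ℤ) siteLaw (i := fun i : ℕ => (n : ℤ) + i)
      (fun a b h => by simpa using h) (hm T) (siteLaw_quiet T)
    filter_upwards [this] with y hy
    simpa [ringTime_eq_arrival] using hy
  have h4 : ∀ᵐ y ∂driveLaw, ∀ T n : ℕ, ∃ i : ℕ, (T : ℝ) < ringTime y (-n - i) 0 := by
    simp only [ae_all_iff]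
    intro T n
    have := ae_exists_mem_infinitePi (ι := ℤ) siteLaw (i := fun i : ℕ => -(n : ℤ) - i)
      (fun a b h => by simpa using h) (hm T) (siteLaw_quiet T)
    filter_upwards [this] with y hy
    simpa [ringTime_eq_arrival] using hy
  filter_upwards [h1, h2, h3, h4] with y h1 h2 h3 h4
  exact ⟨h1, h2, h3, h4⟩

end AlmostSure

/-! ### Measurability of the automaton -/

section Measurability

lemma measurable_signedDiff : Measurable fun p : Opinion × Opinion => signedDiff p.1 p.2 := by
  have h1 : Measurable fun x : Opinion => ((AddCircle.equivIoc (2 : ℝ) (-1) x : _) : ℝ) :=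
    measurable_subtype_coe.comp (AddCircle.measurableEquivIoc (2 : ℝ) (-1)).measurable
  exact h1.comp (measurable_snd.sub measurable_fst)

lemma measurable_geodesicStep :
    Measurable fun p : Bool × Opinion × Opinion => geodesicStep p.1 p.2.1 p.2.2 := by
  unfold geodesicStep
  refine Measurable.ite (measurableSet_eq_fun (by fun_prop) measurable_const) ?_
    (measurable_signedDiff.comp measurable_snd)
  exact (measurable_of_countable fun c : Bool => if c then (1 : ℝ) else -1).comp measurable_fst

variable {Ω : Type*} [MeasurableSpace Ω]

lemma measurable_updateLeft (μ : ℝ) {c : Ω → Bool} {x y : Ω → Opinion} (hc : Measurable c)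
    (hx : Measurable x) (hy : Measurable y) :
    Measurable fun ω => updateLeft μ (c ω) (x ω) (y ω) :=
  hx.add (AddCircle.measurable_mk'.comp
    ((measurable_geodesicStep.comp (hc.prodMk (hx.prodMk hy))).const_mul μ))

lemma measurable_updateRight (μ : ℝ) {c : Ω → Bool} {x y : Ω → Opinion} (hc : Measurable c)
    (hx : Measurable x) (hy : Measurable y) :
    Measurable fun ω => updateRight μ (c ω) (x ω) (y ω) :=
  hy.sub (AddCircle.measurable_mk'.comp
    ((measurable_geodesicStep.comp (hc.prodMk (hx.prodMk hy))).const_mul μ))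

lemma measurableSet_active {b : Ω → ℤ → Option Bool} (hb : ∀ e, Measurable fun ω => b ω e) (e : ℤ) :
    MeasurableSet {ω | Active (b ω) e} := by
  have h : ∀ S : Set (Option Bool), MeasurableSet S := fun S =>
    DiscreteMeasurableSpace.forall_measurableSet S
  exact (hb e (h {none}ᶜ)).inter ((hb (e - 1) (h {none})).inter (hb (e + 1) (h {none})))

lemma measurable_step (μ : ℝ) {b : Ω → ℤ → Option Bool} {ξ : Ω → ℤ → Opinion}
    (hb : ∀ e, Measurable fun ω => b ω e) (hξ : ∀ v, Measurable fun ω => ξ ω v) (v : ℤ) :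
    Measurable fun ω => step μ (b ω) (ξ ω) v := by
  have hc : ∀ e, Measurable fun ω => (b ω e).getD false := fun e =>
    (measurable_of_countable fun o : Option Bool => o.getD false).comp (hb e)
  unfold step
  refine Measurable.ite (measurableSet_active hb v) ?_
    (Measurable.ite (measurableSet_active hb (v - 1)) ?_ (hξ v))
  · exact measurable_updateLeft μ (hc v) (hξ v) (hξ (v + 1))
  · exact measurable_updateRight μ (hc (v - 1)) (hξ (v - 1)) (hξ v)

lemma measurable_traj (μ : ℝ) {b : Ω → ℕ → ℤ → Option Bool} {ξ : Ω → ℤ → Opinion}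
    (hb : ∀ j e, Measurable fun ω => b ω j e) (hξ : ∀ v, Measurable fun ω => ξ ω v) (j : ℕ)
    (v : ℤ) : Measurable fun ω => traj μ (ξ ω) (b ω) j v := by
  induction j generalizing v with
  | zero => exact hξ v
  | succ j ih => exact measurable_step μ (hb j) ih v

lemma traj_congr (μ : ℝ) {b b' : ℕ → ℤ → Option Bool} {ξ : ℤ → Opinion} {j : ℕ}
    (h : ∀ i < j, b i = b' i) : traj μ ξ b j = traj μ ξ b' j := by
  induction j with
  | zero => rfl
  | succ j ih => rw [traj, traj, ih fun i hi => h i (by omega), h j (by omega)]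

lemma measurable_approx (μ h : ℝ) (j : ℕ) (v : ℤ) :
    Measurable fun y => approx μ h y j v :=
  measurable_traj μ (fun j e => (measurable_cell h j).comp (by fun_prop)) (fun v => by fun_prop) j v

lemma measurable_approx_cell (h : ℝ) (j : ℕ) (e : ℤ) :
    Measurable fun y : Drive => cell h j (y e).2 :=
  (measurable_cell h j).comp (by fun_prop)

end Measurability

/-! ### Translation, half-turn rotation and finite speed of propagation -/

section Symmetries

/-- Translation by one vertex. -/
def translate (y : Drive) : Drive := fun v => y (v + 1)

lemma measurePreserving_translate : MeasurePreserving translate driveLaw driveLaw where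
  measurable := measurable_pi_lambda _ fun v => measurable_pi_apply _
  map_eq := Measure.map_infinitePi_infinitePi_of_inj (P := fun _ : ℤ => siteLaw)
    (f := fun v : ℤ => v + 1) fun a b h => by simpa using h

lemma step_translate (μ : ℝ) (b : ℤ → Option Bool) (ξ : ℤ → Opinion) (v : ℤ) :
    step μ (fun e => b (e + 1)) (fun u => ξ (u + 1)) v = step μ b ξ (v + 1) := by
  have h1 : ∀ e, Active (fun e => b (e + 1)) e ↔ Active b (e + 1) := fun e => by
    simp only [Active, sub_add_cancel, add_sub_cancel_right]
  simp only [step, h1, sub_add_cancel, add_sub_cancel_right]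

lemma approx_translate (μ h : ℝ) (y : Drive) (j : ℕ) (v : ℤ) :
    approx μ h (translate y) j v = approx μ h y j (v + 1) := by
  induction j generalizing v with
  | zero => rfl
  | succ j ih =>
    rw [approx_succ, approx_succ, ← step_translate]
    congr 1
    funext u
    exact ih u

/-- Rotation by a half turn of all initial opinions at the vertices from `n` on. -/
noncomputable def rotate (n : ℤ) (y : Drive) : Drive :=
  fun v => if n ≤ v then ((y v).1 + ((1 : ℝ) : Opinion), (y v).2) else y v

lemma measurePreserving_rotate (n : ℤ) : MeasurePreserving (rotate n) driveLaw driveLaw := by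
  have h1 : MeasurePreserving (fun z : SiteData => (z.1 + ((1 : ℝ) : Opinion), z.2))
      siteLaw siteLaw :=
    (measurePreserving_add_right (AddCircle.haarAddCircle (T := 2)) _).prod
      (MeasurePreserving.id edgeLaw)
  let f : ℤ → SiteData → SiteData := fun v z =>
    if n ≤ v then (z.1 + ((1 : ℝ) : Opinion), z.2) else z
  have hf : ∀ v, MeasurePreserving (f v) siteLaw siteLaw := fun v => by
    by_cases hv : n ≤ v
    · simpa [f, hv] using h1
    · have : f v = id := by
        funext z
        simp [f, hv]
      rw [this]
      exact MeasurePreserving.id siteLaw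
  have h2 : rotate n = fun y v => f v (y v) := rfl
  refine ⟨?_, ?_⟩
  · rw [h2]
    exact measurable_pi_lambda _ fun v => (hf v).measurable.comp (measurable_pi_apply v)
  · rw [h2, driveLaw, Measure.infinitePi_map_pi _ fun v => (hf v).measurable]
    simp only [(hf _).map_eq]

lemma rotate_snd (n : ℤ) (y : Drive) (v : ℤ) : (rotate n y v).2 = (y v).2 := by
  unfold rotate
  split_ifs <;> rfl

/-- One step looks only at nearest neighbours, so after j steps the rotation has been felt at most j
vertices beyond its boundary. -/
lemma approx_rotate_of_lt (μ h : ℝ) (n : ℤ) (y : Drive) (j : ℕ) (v : ℤ) (hv : v + j < n) :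
    approx μ h (rotate n y) j v = approx μ h y j v := by
  induction j generalizing v with
  | zero =>
    rw [approx_zero, approx_zero, rotate, if_neg]
    simp at hv
    omega
  | succ j ih =>
    push_cast at hv
    simp only [approx_succ, rotate_snd]
    exact step_congr (ih _ (by omega)) (ih _ (by omega)) (ih _ (by omega))

lemma approx_rotate_of_ge (μ h : ℝ) (n : ℤ) (y : Drive) (j : ℕ) (v : ℤ) (hv : n + j ≤ v) :
    approx μ h (rotate n y) j v = approx μ h y j v + ((1 : ℝ) : Opinion) := by
  induction j generalizing v with
  | zero =>
    rw [approx_zero, approx_zero, rotate, if_pos]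
    simpa using hv
  | succ j ih =>
    push_cast at hv
    simp only [approx_succ, rotate_snd]
    rw [← step_add_right]
    exact step_congr (ih _ (by omega)) (ih _ (by omega)) (ih _ (by omega))

end Symmetries

/-! ### Independence of the configuration and the later clocks -/

section PastFuture

/-- The restriction of the data of a site to the first `J` time cells. -/
noncomputable def sitePast (h : ℝ) (J : ℕ) (z : SiteData) : Opinion × (Fin J → Option Bool) :=
  (z.1, fun i => cell h i z.2)

lemma measurable_sitePast (h : ℝ) (J : ℕ) : Measurable (sitePast h J) :=
  measurable_fst.prodMk (measurable_pi_lambda _ fun i => (measurable_cell h i).comp measurable_snd)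

lemma indepFun_sitePast {h : ℝ} (hh : 0 ≤ h) (J : ℕ) :
    IndepFun (sitePast h J) (fun z => (shift h)^[J] z.2) siteLaw := by
  have hs := (measurable_shift h).iterate J
  rw [indepFun_iff_measure_inter_preimage_eq_mul]
  intro A G hA hG
  have hA' := measurable_sitePast h J hA
  have hG' : MeasurableSet ((fun z : SiteData => (shift h)^[J] z.2) ⁻¹' G) :=
    (hs.comp measurable_snd) hG
  rw [siteLaw_eq, Measure.prod_apply (hA'.inter hG'), Measure.prod_apply hA']
  have h1 : (AddCircle.haarAddCircle.prod edgeLaw) ((fun z : SiteData => (shift h)^[J] z.2) ⁻¹' G)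
      = edgeLaw ((shift h)^[J] ⁻¹' G) :=
    measurePreserving_edgeData.measure_preimage (hs hG).nullMeasurableSet
  rw [h1, ← lintegral_mul_const']
  · refine lintegral_congr fun a => ?_
    have h2 : MeasurableSet {v : Fin J → Option Bool | (a, v) ∈ A} := measurable_prodMk_left hA
    exact (indepFun_iff_measure_inter_preimage_eq_mul.1 (indepFun_cell_shift hh J)) _ G h2 hG
  · exact measure_ne_top _ _

/-- The edge data seen from the time cell number `J`. -/
noncomputable def future (h : ℝ) (J : ℕ) (y : Drive) : ℤ → EdgeData :=
  fun e => (shift h)^[J] (y e).2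

lemma measurePreserving_future {h : ℝ} (hh : 0 ≤ h) (J : ℕ) :
    MeasurePreserving (future h J) driveLaw (Measure.infinitePi fun _ : ℤ => edgeLaw) := by
  have hs : MeasurePreserving ((shift h)^[J]) edgeLaw edgeLaw := by
    refine ⟨(measurable_shift h).iterate J, ?_⟩
    ext G hG
    rw [Measure.map_apply ((measurable_shift h).iterate J) hG, edgeLaw_iterate_shift hh J hG]
  have hf := hs.comp measurePreserving_edgeData
  refine ⟨measurable_pi_lambda _ fun e => hf.measurable.comp (measurable_pi_apply e), ?_⟩
  have h1 := Measure.infinitePi_map_pi (fun _ : ℤ => siteLaw)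
    (f := fun _ z => (shift h)^[J] z.2) fun _ => hf.measurable
  have h2 : siteLaw.map (fun z => (shift h)^[J] z.2) = edgeLaw := hf.map_eq
  simp only [h2] at h1
  exact h1

/-- The configuration after J steps is a function of the initial opinions and the first J cells,
which are independent of the future at each site and hence jointly. -/
lemma indepFun_approx_future (μ : ℝ) {h : ℝ} (hh : 0 ≤ h) (J : ℕ) :
    IndepFun (fun y => approx μ h y J) (future h J) driveLaw := by
  have h1 : IndepFun (fun (y : Drive) e => sitePast h J (y e)) (future h J) driveLaw :=
    indepFun_infinitePi (ι := ℤ) siteLaw (measurable_sitePast h J)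
      (((measurable_shift h).iterate J).comp measurable_snd) (indepFun_sitePast hh J)
  -- The value `none` for cells from J on is a filler that J steps never read.
  let Φ : (ℤ → Opinion × (Fin J → Option Bool)) → ℤ → Opinion := fun p =>
    traj μ (fun v => (p v).1) (fun i e => if hi : i < J then (p e).2 ⟨i, hi⟩ else none) J
  have hΦ : Measurable Φ := by
    refine measurable_pi_lambda _ fun v => measurable_traj μ (fun i e => ?_) (fun v => ?_) J v
    · by_cases hi : i < J
      · simp only [hi, dite_true]
        fun_prop
      · simp only [hi, dite_false]
        fun_prop
    · fun_prop
  have h2 : (fun y => approx μ h y J) = Φ ∘ fun (y : Drive) e => sitePast h J (y e) := by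
    funext y
    refine traj_congr μ fun i hi => ?_
    funext e
    simp only [hi, dite_true]
    rfl
  rw [h2]
  exact h1.comp (ψ := id) hΦ measurable_id

end PastFuture

/-! ### Monotonicity of the mean gap -/

section MeanGap

lemma integral_eq_of_translate {F : Drive → ℤ → ℝ} (hF : ∀ e, Measurable fun y => F y e)
    (hF' : ∀ y e, F (translate y) e = F y (e + 1)) (e : ℤ) :
    ∫ y, F y e ∂driveLaw = ∫ y, F y 0 ∂driveLaw := by
  have h1 : ∀ e, ∫ y, F y (e + 1) ∂driveLaw = ∫ y, F y e ∂driveLaw := by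
    intro e
    conv_rhs => rw [← measurePreserving_translate.map_eq]
    rw [integral_map measurePreserving_translate.measurable.aemeasurable
      (hF e).aestronglyMeasurable]
    simp only [hF']
  induction e using Int.induction_on with
  | zero => rfl
  | succ i ih => rw [h1, ih]
  | pred i ih => rw [← h1, sub_add_cancel, ih]

/-- The rings in the time cell number `j`. -/
noncomputable def cells (h : ℝ) (j : ℕ) (y : Drive) : ℤ → Option Bool := fun e => cell h j (y e).2

/-- The mean distance of neighbouring opinions in the discretized model. -/
noncomputable def meanGap (μ h : ℝ) (j : ℕ) : ℝ := ∫ y, gap (approx μ h y j) 0 ∂driveLaw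

variable (μ h : ℝ) (j : ℕ)

lemma measurable_gap_approx (e : ℤ) : Measurable fun y => gap (approx μ h y j) e :=
  (measurable_approx μ h j e).dist (measurable_approx μ h j (e + 1))

lemma measurable_flow_approx (e : ℤ) :
    Measurable fun y => flow μ (cells h j y) (approx μ h y j) e :=
  Measurable.ite (measurableSet_active (measurable_approx_cell h j) e)
    ((measurable_gap_approx μ h j e).const_mul μ) measurable_const

lemma integrable_gap_approx (e : ℤ) : Integrable (fun y => gap (approx μ h y j) e) driveLaw :=
  Integrable.of_bound (measurable_gap_approx μ h j e).aestronglyMeasurable 1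
    (Eventually.of_forall fun y => by
      rw [Real.norm_of_nonneg (gap_nonneg _ _)]
      exact gap_le_one _ _)

lemma integrable_flow_approx (e : ℤ) :
    Integrable (fun y => flow μ (cells h j y) (approx μ h y j) e) driveLaw :=
  Integrable.of_bound (measurable_flow_approx μ h j e).aestronglyMeasurable |μ|
    (Eventually.of_forall fun y => by
      rw [flow]
      split_ifs
      · rw [Real.norm_eq_abs, abs_mul, abs_of_nonneg (gap_nonneg _ _)]
        exact mul_le_of_le_one_right (abs_nonneg μ) (gap_le_one _ _)
      · simp)

lemma integral_gap_approx (e : ℤ) :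
    ∫ y, gap (approx μ h y j) e ∂driveLaw = meanGap μ h j :=
  integral_eq_of_translate (F := fun y e => gap (approx μ h y j) e) (measurable_gap_approx μ h j)
    (fun y e => by simp only [gap, approx_translate]) e

lemma integral_flow_approx (e : ℤ) :
    ∫ y, flow μ (cells h j y) (approx μ h y j) e ∂driveLaw
      = ∫ y, flow μ (cells h j y) (approx μ h y j) 0 ∂driveLaw := by
  refine integral_eq_of_translate (F := fun y e => flow μ (cells h j y) (approx μ h y j) e)
    (measurable_flow_approx μ h j) (fun y e => ?_) e
  have h1 : Active (cells h j (translate y)) e ↔ Active (cells h j y) (e + 1) := by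
    simp only [Active, cells, translate, sub_add_cancel, add_sub_cancel_right]
  simp only [flow, h1, gap, approx_translate]

lemma integrable_loss_approx (e : ℤ) :
    Integrable (fun y => loss μ (cells h j y) (approx μ h y j) e) driveLaw :=
  ((((integrable_gap_approx μ h j e).sub ((integrable_flow_approx μ h j e).const_mul 2)).add
    (integrable_flow_approx μ h j (e - 1))).add (integrable_flow_approx μ h j (e + 1))).sub
    (integrable_gap_approx μ h (j + 1) e)

/-- All edges have the same mean flow, so the exchange terms cancel as −2 + 1 + 1. -/
lemma integral_loss_approx (e : ℤ) :
    ∫ y, loss μ (cells h j y) (approx μ h y j) e ∂driveLaw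
      = meanGap μ h j - meanGap μ h (j + 1) := by
  have i1 := integrable_gap_approx μ h j e
  have i2 := (integrable_flow_approx μ h j e).const_mul 2
  have i3 := integrable_flow_approx μ h j (e - 1)
  have i4 := integrable_flow_approx μ h j (e + 1)
  have i5 := integrable_gap_approx μ h (j + 1) e
  have h1 : ∀ y, loss μ (cells h j y) (approx μ h y j) e
      = gap (approx μ h y j) e - 2 * flow μ (cells h j y) (approx μ h y j) e
        + flow μ (cells h j y) (approx μ h y j) (e - 1)
        + flow μ (cells h j y) (approx μ h y j) (e + 1) - gap (approx μ h y (j + 1)) e :=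
    fun y => rfl
  have i12 : Integrable (fun y => gap (approx μ h y j) e
      - 2 * flow μ (cells h j y) (approx μ h y j) e) driveLaw := i1.sub i2
  have i13 : Integrable (fun y => gap (approx μ h y j) e
      - 2 * flow μ (cells h j y) (approx μ h y j) e
      + flow μ (cells h j y) (approx μ h y j) (e - 1)) driveLaw := i12.add i3
  have i14 : Integrable (fun y => gap (approx μ h y j) e
      - 2 * flow μ (cells h j y) (approx μ h y j) e
      + flow μ (cells h j y) (approx μ h y j) (e - 1)
      + flow μ (cells h j y) (approx μ h y j) (e + 1)) driveLaw := i13.add i4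
  simp only [h1]
  rw [integral_sub i14 i5, integral_add i13 i4, integral_add i12 i3, integral_sub i1 i2,
    integral_const_mul,
    integral_flow_approx μ h j e, integral_flow_approx μ h j (e - 1),
    integral_flow_approx μ h j (e + 1), integral_gap_approx, integral_gap_approx]
  ring

variable {μ}

lemma antitone_meanGap (hμ0 : 0 < μ) (hμ1 : μ ≤ 1 / 2) : Antitone (meanGap μ h) :=
  antitone_nat_of_succ_le fun j => by
    have h1 := integral_loss_approx μ h j 0
    have h2 : 0 ≤ ∫ y, loss μ (cells h j y) (approx μ h y j) 0 ∂driveLaw :=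
      integral_nonneg fun y => loss_nonneg hμ0.le hμ1 0
    linarith

end MeanGap

/-! ### The sweeping pattern and its probability -/

section Pattern

/-- The cell number i of mesh 1/m lies in the unit cell number `i / m`. The pattern can thus be
prescribed on unit cells, with a probability that does not depend on m. -/
lemma Regular.cell_eq_none_of_coarse {x : EdgeData} (hx : Regular x.1) {m i : ℕ} (hm : 1 ≤ m)
    (h : cell 1 (i / m) x = none) : cell (1 / m) i x = none := by
  have hm0 : (0 : ℝ) < m := by exact_mod_cast hm
  rw [hx.cell_eq_none_iff zero_le_one] at h
  rw [hx.cell_eq_none_iff (by positivity)]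
  rintro k ⟨h1, h2⟩
  refine h k ⟨?_, ?_⟩
  · refine lt_of_le_of_lt ?_ h1
    rw [mul_one, mul_one_div]
    exact Nat.cast_div_le
  · refine h2.trans ?_
    rw [mul_one, mul_one_div, div_le_iff₀ hm0]
    have : i + 1 ≤ (i / m + 1) * m := (Nat.div_lt_iff_lt_mul hm).1 (Nat.lt_succ_self _)
    exact_mod_cast this

lemma Regular.exists_fine_cell_ne_none {x : EdgeData} (hx : Regular x.1) {m r : ℕ} (hm : 1 ≤ m)
    (h : cell 1 r x ≠ none) :
    ∃ i, r * m ≤ i ∧ i < (r + 1) * m ∧ cell (1 / m) i x ≠ none := by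
  have hm0 : (0 : ℝ) < m := by exact_mod_cast hm
  rw [Ne, hx.cell_eq_none_iff zero_le_one] at h
  push Not at h
  obtain ⟨k, h1, h2⟩ := h
  rw [mul_one] at h1 h2
  set τ := arrival x.1 k with hτ
  -- Cells are open on the left and closed on the right, so the cell containing τ has number ⌈τm⌉ −
  -- 1.
  have hpos : 0 < ⌈τ * m⌉₊ := by
    rw [Nat.ceil_pos]
    have : (0 : ℝ) ≤ r := Nat.cast_nonneg r
    exact mul_pos (by linarith) hm0
  obtain ⟨i, hi⟩ : ∃ i, ⌈τ * m⌉₊ = i + 1 := ⟨⌈τ * m⌉₊ - 1, by omega⟩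
  have hi1 : (i : ℝ) < τ * m := by
    have : i < ⌈τ * m⌉₊ := by omega
    exact Nat.lt_ceil.1 this
  have hi2 : τ * m ≤ i + 1 := by
    have := Nat.le_ceil (τ * m)
    rw [hi] at this
    exact_mod_cast this
  refine ⟨i, ?_, ?_, ?_⟩
  · have h3 : ((r * m : ℕ) : ℝ) < ((i + 1 : ℕ) : ℝ) := by
      push_cast
      exact (mul_lt_mul_of_pos_right h1 hm0).trans_le hi2
    have : r * m < i + 1 := by exact_mod_cast h3
    omega
  · have h3 : (i : ℝ) < (((r + 1) * m : ℕ) : ℝ) := by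
      push_cast
      exact hi1.trans_le (mul_le_mul_of_nonneg_right h2 hm0.le)
    exact_mod_cast h3
  · rw [Ne, hx.cell_eq_none_iff (by positivity)]
    push Not
    refine ⟨k, ?_, ?_⟩
    · rw [mul_one_div, div_lt_iff₀ hm0]
      exact hi1
    · rw [mul_one_div, le_div_iff₀ hm0]
      exact hi2

/-- In the sweeping pattern, the inner edges of the window `0, …, N` ring in alternation: those
with the parity of `r` ring in the unit of time number `r`. -/
def Scheduled (N : ℕ) (e : ℕ) (r : ℕ) : Prop := 0 < e ∧ e < N ∧ (e + r) % 2 = 0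

/-- The edge `e` rings according to the sweeping pattern for `2 Q` units of time. -/
def patternSet (N Q e : ℕ) : Set EdgeData :=
  {x | ∀ r < 2 * Q, cell 1 r x ∈ {o | o ≠ none ↔ Scheduled N e r}}

lemma measurableSet_patternSet (N Q e : ℕ) : MeasurableSet (patternSet N Q e) := by
  have : patternSet N Q e
      = ⋂ r, ⋂ (_ : r < 2 * Q), cell 1 r ⁻¹' {o | o ≠ none ↔ Scheduled N e r} := by
    ext x
    simp [patternSet]
  rw [this]
  exact MeasurableSet.iInter fun i => MeasurableSet.iInter fun _ =>
    measurable_cell 1 i (DiscreteMeasurableSpace.forall_measurableSet _)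

/-- The cells are independent, and each unit cell contains a ring with probability 1 − 1/e, strictly
between 0 and 1. -/
lemma edgeLaw_patternSet_pos (N Q e : ℕ) : edgeLaw (patternSet N Q e) ≠ 0 := by
  have h1 := edgeLaw_cell_shift zero_le_one (2 * Q) (fun r => {o | o ≠ none ↔ Scheduled N e r})
    MeasurableSet.univ
  simp only [Set.mem_univ, and_true, measure_univ, mul_one] at h1
  rw [patternSet, h1, Finset.prod_ne_zero_iff]
  intro r _
  have hE : MeasurePreserving (fun x : EdgeData => x.1 0) edgeLaw (expMeasure 1) :=
    (measurePreserving_eval_infinitePi (fun _ : ℕ => expMeasure 1) 0).comp measurePreserving_fst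
  by_cases hr : Scheduled N e r
  · have h2 : {x | obs 1 x ∈ {o | o ≠ none ↔ Scheduled N e r}}
        = (fun x : EdgeData => x.1 0) ⁻¹' Set.Iic 1 := by
      ext x
      simp [obs, hr]
    rw [h2, hE.measure_preimage measurableSet_Iic.nullMeasurableSet, expMeasure_Iic,
      if_pos zero_le_one, Ne, ENNReal.ofReal_eq_zero, not_le, sub_pos, Real.exp_lt_one_iff]
    norm_num
  · have h2 : {x | obs 1 x ∈ {o | o ≠ none ↔ Scheduled N e r}}
        = (fun x : EdgeData => x.1 0) ⁻¹' Set.Ioi 1 := by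
      ext x
      simp [obs, hr]
    rw [h2, hE.measure_preimage measurableSet_Ioi.nullMeasurableSet,
      expMeasure_Ioi zero_le_one, Ne, ENNReal.ofReal_eq_zero, not_le]
    exact Real.exp_pos _

/-- All edges of the window ring according to the sweeping pattern. -/
def patternEvent (N Q : ℕ) : Set (ℤ → EdgeData) :=
  {x | ∀ e : ℕ, e ≤ N → x e ∈ patternSet N Q e}

lemma patternEvent_eq (N Q : ℕ) : patternEvent N Q
    = Set.pi ((Finset.range (N + 1)).image ((↑) : ℕ → ℤ)) fun e => patternSet N Q e.toNat := by
  ext x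
  simp [patternEvent]

lemma measurableSet_patternEvent (N Q : ℕ) : MeasurableSet (patternEvent N Q) := by
  rw [patternEvent_eq]
  exact MeasurableSet.pi (Finset.countable_toSet _) fun _ _ => measurableSet_patternSet _ _ _

/-- The probability of the sweeping pattern. -/
noncomputable def patternProb (N Q : ℕ) : ℝ :=
  (Measure.infinitePi fun _ : ℤ => edgeLaw).real (patternEvent N Q)

lemma patternProb_pos (N Q : ℕ) : 0 < patternProb N Q := by
  refine ENNReal.toReal_pos ?_ (measure_ne_top _ _)
  rw [patternEvent_eq, Measure.infinitePi_pi _ fun _ _ => measurableSet_patternSet _ _ _,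
    Finset.prod_ne_zero_iff]
  exact fun e _ => edgeLaw_patternSet_pos _ _ _

end Pattern

/-! ### Decrease of the mean gap forced by the pattern -/

section Sweep

variable {μ : ℝ}

/-- The pattern supplies what `window_mass_le` asks for. A period is two units of time, that is, 2m
cells. Within it each inner edge rings during a unit in which both its neighbours, of the other
parity or at the silent ends, do not ring, so it is active in some cell. -/
lemma sweep_mass_le (hμ0 : 0 < μ) (hμ1 : μ ≤ 1 / 2) {N Q m : ℕ} (hN : 1 ≤ N) (hm : 1 ≤ m)
    (hQ : (N : ℝ) ^ 5 * (1 / μ + 4) ≤ Q) {y : Drive} (hy : ∀ e, Regular (y e).2.1) (J : ℕ)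
    (hA : future (1 / m) J y ∈ patternEvent N Q) :
    ∑ i ∈ Finset.range N, ((N : ℝ) - i) * gap (approx μ (1 / m) y J) i
      ≤ N + 1 + N * ∑ j ∈ Finset.range (Q * (2 * m)), ∑ i ∈ Finset.range N,
        loss μ (cells (1 / m) (j + J) y) (approx μ (1 / m) y (j + J)) i := by
  have hreg : ∀ e, Regular (future (1 / m) J y e).1 := fun e => (hy e).iterate_shift _ _
  have hcell : ∀ j e, cells (1 / m) (j + J) y e = cell (1 / m) j (future (1 / m) J y e) :=
    fun j e => cell_add _ _ _ _
  have hdiv : ∀ j < Q * (2 * m), j / m < 2 * Q := fun j hj => by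
    rw [Nat.div_lt_iff_lt_mul hm]
    calc j < Q * (2 * m) := hj
      _ = 2 * Q * m := by ring
  have hnone : ∀ j < Q * (2 * m), ∀ e : ℕ, e ≤ N → ¬ Scheduled N e (j / m) →
      cells (1 / m) (j + J) y e = none := by
    intro j hj e he hs
    rw [hcell]
    refine (hreg e).cell_eq_none_of_coarse hm ?_
    have h1 := hA e he (j / m) (hdiv j hj)
    by_contra h2
    exact hs (h1.1 h2)
  have key := window_mass_le (μ := μ) hμ0
    (g := fun j i => gap (approx μ (1 / m) y (j + J)) i)
    (f := fun j i => flow μ (cells (1 / m) (j + J) y) (approx μ (1 / m) y (j + J)) i)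
    (l := fun j i => loss μ (cells (1 / m) (j + J) y) (approx μ (1 / m) y (j + J)) i)
    (fun j i => gap_nonneg _ _) (fun j i => gap_le_one _ _) (fun j i => flow_nonneg hμ0.le _)
    (fun j i => loss_nonneg hμ0.le hμ1 _)
    (fun j i => by
      have h1 : gap (approx μ (1 / m) y (j + 1 + J)) i
          = gap (step μ (cells (1 / m) (j + J) y) (approx μ (1 / m) y (j + J))) i := by
        rw [show j + 1 + J = (j + J) + 1 by ring]
        rfl
      simp only [h1, loss]
      ring)
    (fun j i => by
      simp only [show j + 1 + J = (j + J) + 1 by ring, approx_succ]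
      exact gap_le_gap_step_add hμ0.le i)
    (N := N) (M := 2 * m) (Q := Q) hN hQ
    (fun j hj => flow_of_not_active fun h => h.1
      (hnone j hj 0 (Nat.zero_le N) fun hs => absurd hs.1 (lt_irrefl 0)))
    (fun j hj => flow_of_not_active fun h => h.1
      (hnone j hj N le_rfl fun hs => absurd hs.2.1 (lt_irrefl N)))
    (fun q hq i hi1 hiN => by
      obtain ⟨r, hr1, hr2, hr3⟩ : ∃ r, 2 * q ≤ r ∧ r < 2 * q + 2 ∧ (i + r) % 2 = 0 := by
        rcases Nat.mod_two_eq_zero_or_one i with h | h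
        · exact ⟨2 * q, by omega, by omega, by omega⟩
        · exact ⟨2 * q + 1, by omega, by omega, by omega⟩
      have hrQ : r < 2 * Q := by omega
      have hri : cell 1 r (future (1 / m) J y i) ≠ none :=
        (hA i hiN.le r hrQ).2 ⟨by omega, hiN, hr3⟩
      obtain ⟨j, hj1, hj2, hj3⟩ := (hreg i).exists_fine_cell_ne_none hm hri
      have hjr : j / m = r := Nat.div_eq_of_lt_le hj1 hj2
      have hlo : q * (2 * m) ≤ j := by
        calc q * (2 * m) = 2 * q * m := by ring
          _ ≤ r * m := Nat.mul_le_mul_right _ hr1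
          _ ≤ j := hj1
      have hhi : j < (q + 1) * (2 * m) := by
        calc j < (r + 1) * m := hj2
          _ ≤ (2 * q + 2) * m := Nat.mul_le_mul_right _ (by omega)
          _ = (q + 1) * (2 * m) := by ring
      have hjQ : j < Q * (2 * m) := hhi.trans_le (Nat.mul_le_mul_right _ hq)
      refine ⟨j, hlo, hhi, flow_of_active ⟨?_, ?_, ?_⟩⟩
      · rw [hcell]
        exact hj3
      · have h1 := hnone j hjQ (i - 1) (by omega) (by
          rw [hjr]
          rintro ⟨-, -, h2⟩
          omega)
        rwa [Nat.cast_sub hi1, Nat.cast_one] at h1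
      · have h1 := hnone j hjQ (i + 1) (by omega) (by
          rw [hjr]
          rintro ⟨-, -, h2⟩
          omega)
        rwa [Nat.cast_add, Nat.cast_one] at h1)
  simpa only [zero_add] using key

/-- As long as the mean gap is large, it decreases. -/
lemma patternProb_mul_le (hμ0 : 0 < μ) (hμ1 : μ ≤ 1 / 2) {N Q m : ℕ} (hN : 1 ≤ N) (hm : 1 ≤ m)
    (hQ : (N : ℝ) ^ 5 * (1 / μ + 4) ≤ Q) (J : ℕ) :
    patternProb N Q * ((N * (N + 1) / 2 : ℝ) * meanGap μ (1 / m) J - (N + 1))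
      ≤ N ^ 2 * (meanGap μ (1 / m) J - meanGap μ (1 / m) (J + Q * (2 * m))) := by
  have hh : (0 : ℝ) ≤ 1 / m := by positivity
  set h : ℝ := 1 / m with hh_def
  set A : Set Drive := future h J ⁻¹' patternEvent N Q with hA
  have hfut := measurePreserving_future hh J
  have hAm : MeasurableSet A := hfut.measurable (measurableSet_patternEvent N Q)
  have hAp : driveLaw.real A = patternProb N Q := by
    rw [measureReal_def, hA,
      hfut.measure_preimage (measurableSet_patternEvent N Q).nullMeasurableSet]
    rfl
  set H : (ℤ → Opinion) → ℝ := fun ξ => ∑ i ∈ Finset.range N, ((N : ℝ) - i) * gap ξ i with hH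
  set Λ : Drive → ℝ := fun y => ∑ j ∈ Finset.range (Q * (2 * m)), ∑ i ∈ Finset.range N,
    loss μ (cells h (j + J) y) (approx μ h y (j + J)) i with hΛ
  have hHm : Measurable H := by
    rw [hH]
    unfold gap
    fun_prop
  have hHint : Integrable (fun y => H (approx μ h y J)) driveLaw :=
    integrable_finsetSum _ fun i _ => (integrable_gap_approx μ h J i).const_mul _
  have hHmean : ∫ y, H (approx μ h y J) ∂driveLaw = (N * (N + 1) / 2 : ℝ) * meanGap μ h J := by
    rw [hH]
    simp only
    rw [integral_finsetSum _ fun (i : ℕ) _ =>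
      (integrable_gap_approx μ h J (i : ℤ)).const_mul ((N : ℝ) - i)]
    simp only [integral_const_mul, integral_gap_approx]
    rw [← Finset.sum_mul]
    congr 1
    have : ∀ n : ℕ, ∑ i ∈ Finset.range n, ((i : ℝ)) = n * (n - 1) / 2 := by
      intro n
      induction n with
      | zero => simp
      | succ n ih =>
        rw [Finset.sum_range_succ, ih]
        push_cast
        ring
    rw [Finset.sum_sub_distrib, this, Finset.sum_const, Finset.card_range, nsmul_eq_mul]
    ring
  have hΛint : Integrable Λ driveLaw :=
    integrable_finsetSum _ fun j _ => integrable_finsetSum _ fun i _ =>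
      integrable_loss_approx μ h (j + J) i
  have hΛ0 : ∀ y, 0 ≤ Λ y := fun y => Finset.sum_nonneg fun j _ => Finset.sum_nonneg fun i _ =>
    loss_nonneg hμ0.le hμ1 _
  -- The mean losses telescope in time.
  have hΛmean : ∫ y, Λ y ∂driveLaw
      = N * (meanGap μ h J - meanGap μ h (J + Q * (2 * m))) := by
    rw [hΛ]
    simp only
    rw [integral_finsetSum _ fun j _ => integrable_finsetSum _ fun (i : ℕ) _ =>
      integrable_loss_approx μ h (j + J) (i : ℤ)]
    have h1 : ∀ j, ∫ y, ∑ i ∈ Finset.range N, loss μ (cells h (j + J) y)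
        (approx μ h y (j + J)) i ∂driveLaw
        = N * (meanGap μ h (j + J) - meanGap μ h (j + 1 + J)) := by
      intro j
      rw [integral_finsetSum _ fun (i : ℕ) _ => integrable_loss_approx μ h (j + J) (i : ℤ)]
      simp only [integral_loss_approx]
      rw [Finset.sum_const, Finset.card_range, nsmul_eq_mul, show j + J + 1 = j + 1 + J by ring]
    simp only [h1]
    rw [← Finset.mul_sum, Finset.sum_range_sub' (fun j => meanGap μ h (j + J)), zero_add,
      add_comm (Q * (2 * m)) J]
  -- the mass in the window is independent of the pattern
  have hind : ∫ y in A, H (approx μ h y J) ∂driveLaw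
      = patternProb N Q * ∫ y, H (approx μ h y J) ∂driveLaw := by
    have h1 : IndepFun (fun y => H (approx μ h y J)) (A.indicator fun _ => (1 : ℝ)) driveLaw :=
      (indepFun_approx_future μ hh J).comp
        (ψ := (patternEvent N Q).indicator fun _ => (1 : ℝ)) hHm
        (measurable_const.indicator (measurableSet_patternEvent N Q))
    have h2 := h1.integral_fun_mul_eq_mul_integral hHint.aestronglyMeasurable
      (measurable_const.indicator hAm).aestronglyMeasurable
    rw [integral_indicator hAm, setIntegral_const, smul_eq_mul, mul_one, hAp] at h2
    rw [mul_comm, ← h2, ← integral_indicator hAm]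
    congr 1
    funext y
    by_cases hy : y ∈ A <;> simp [hy]
  have hle : ∫ y in A, H (approx μ h y J) ∂driveLaw
      ≤ ∫ y in A, ((N : ℝ) + 1 + N * Λ y) ∂driveLaw := by
    refine setIntegral_mono_on_ae hHint.integrableOn
      ((integrable_const _).add (hΛint.const_mul _)).integrableOn hAm ?_
    filter_upwards [ae_wellPosed] with y hy hyA
    exact sweep_mass_le hμ0 hμ1 hN hm hQ hy.regular J hyA
  have hsplit : ∫ y in A, ((N : ℝ) + 1 + N * Λ y) ∂driveLaw
      = patternProb N Q * (N + 1) + N * ∫ y in A, Λ y ∂driveLaw := by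
    rw [integral_add (integrable_const _) (hΛint.const_mul _).integrableOn, setIntegral_const,
      integral_const_mul, hAp, smul_eq_mul]
  have hset : ∫ y in A, Λ y ∂driveLaw ≤ ∫ y, Λ y ∂driveLaw :=
    setIntegral_le_integral hΛint (Eventually.of_forall hΛ0)
  rw [hind, hHmean, hsplit] at hle
  have h3 := mul_le_mul_of_nonneg_left hset (Nat.cast_nonneg (α := ℝ) N)
  rw [hΛmean] at h3
  -- Losses off the pattern are nonnegative, so those on it were bounded by the full mean loss; the
  -- two factors N, from the weights and from the number of edges, give N².
  nlinarith [hle, h3]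

end Sweep

/-! ### Passage to continuous time and weak consensus -/

section Model

variable {Ω : Type*} [MeasurableSpace Ω] {P : Measure Ω} {μ : ℝ}
  {η : ℝ≥0 → Ω → ℤ → Opinion} {Y : Ω → Drive}

lemma ae_eventually_approx_eq (hY : HasLaw Y driveLaw P)
    (hη : ∀ᵐ ω ∂P, IsCompassPath μ (Y ω) fun t => η t ω) (t : ℝ≥0) :
    ∀ᵐ ω ∂P, ∀ v, ∀ᶠ m : ℕ in atTop, approx μ (1 / m) (Y ω) ⌈t * m⌉₊ v = η t ω v := by
  have h1 : ∀ᵐ ω ∂P, WellPosed (Y ω) := by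
    have := ae_wellPosed
    rw [← hY.map_eq] at this
    exact ae_of_ae_map hY.aemeasurable this
  filter_upwards [h1, hη] with ω h1 h2 v
  exact h2.eventually_approx_eq h1 t v

lemma aemeasurable_approx_comp (hY : HasLaw Y driveLaw P) (h : ℝ) (j : ℕ) (v : ℤ) :
    AEMeasurable (fun ω => approx μ h (Y ω) j v) P :=
  (measurable_approx μ h j v).comp_aemeasurable hY.aemeasurable

lemma aemeasurable_opinion (hY : HasLaw Y driveLaw P)
    (hη : ∀ᵐ ω ∂P, IsCompassPath μ (Y ω) fun t => η t ω) (t : ℝ≥0) (v : ℤ) :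
    AEMeasurable (fun ω => η t ω v) P := by
  refine aemeasurable_of_tendsto_metrizable_ae atTop
    (f := fun (m : ℕ) ω => approx μ (1 / m) (Y ω) ⌈t * m⌉₊ v)
    (fun m => aemeasurable_approx_comp hY _ _ _) ?_
  filter_upwards [ae_eventually_approx_eq hY hη t] with ω hω
  exact tendsto_nhds_of_eventually_eq (hω v)

lemma integral_gap_comp (hY : HasLaw Y driveLaw P) (h : ℝ) (j : ℕ) (v : ℤ) :
    ∫ ω, dist (approx μ h (Y ω) j v) (approx μ h (Y ω) j (v + 1)) ∂P = meanGap μ h j := by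
  rw [← integral_gap_approx μ h j v, ← hY.map_eq, integral_map hY.aemeasurable
    (measurable_gap_approx μ h j v).aestronglyMeasurable]
  rfl

variable [IsProbabilityMeasure P]

lemma integrable_dist {X Z : Ω → Opinion} (hX : AEMeasurable X P) (hZ : AEMeasurable Z P) :
    Integrable (fun ω => dist (X ω) (Z ω)) P :=
  Integrable.of_bound (hX.dist hZ).aestronglyMeasurable 1 (Eventually.of_forall fun ω => by
    rw [Real.norm_of_nonneg dist_nonneg]
    exact dist_le_one _ _)

/-- Mean distances between random opinions converge along eventually constant sequences. -/
lemma tendsto_integral_dist {X Z : ℕ → Ω → Opinion} {X' Z' : Ω → Opinion}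
    (hX : ∀ m, AEMeasurable (X m) P) (hZ : ∀ m, AEMeasurable (Z m) P)
    (h1 : ∀ᵐ ω ∂P, ∀ᶠ m in atTop, X m ω = X' ω) (h2 : ∀ᵐ ω ∂P, ∀ᶠ m in atTop, Z m ω = Z' ω) :
    Tendsto (fun m => ∫ ω, dist (X m ω) (Z m ω) ∂P) atTop (𝓝 (∫ ω, dist (X' ω) (Z' ω) ∂P)) := by
  refine tendsto_integral_of_dominated_convergence (fun _ => 1)
    (fun m => ((hX m).dist (hZ m)).aestronglyMeasurable) (integrable_const 1) (fun m => ?_) ?_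
  · refine Eventually.of_forall fun ω => ?_
    rw [Real.norm_of_nonneg dist_nonneg]
    exact dist_le_one _ _
  · filter_upwards [h1, h2] with ω h1 h2
    refine tendsto_nhds_of_eventually_eq ?_
    filter_upwards [h1, h2] with m h1 h2
    rw [h1, h2]

lemma tendsto_meanGap (hY : HasLaw Y driveLaw P)
    (hη : ∀ᵐ ω ∂P, IsCompassPath μ (Y ω) fun t => η t ω) (t : ℝ≥0) (v : ℤ) :
    Tendsto (fun m : ℕ => meanGap μ (1 / m) ⌈t * m⌉₊) atTop
      (𝓝 (∫ ω, dist (η t ω v) (η t ω (v + 1)) ∂P)) := by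
  have h1 := ae_eventually_approx_eq hY hη t
  refine (tendsto_integral_dist
    (fun m => aemeasurable_approx_comp (μ := μ) hY (1 / (m : ℝ)) ⌈t * m⌉₊ v)
    (fun m => aemeasurable_approx_comp (μ := μ) hY (1 / (m : ℝ)) ⌈t * m⌉₊ (v + 1))
    (h1.mono fun ω h => h v) (h1.mono fun ω h => h (v + 1))).congr fun m => ?_
  exact integral_gap_comp hY _ _ v

theorem weakConsensusInMean (hμ0 : 0 < μ) (hμ1 : μ ≤ 1 / 2) (hY : HasLaw Y driveLaw P)
    (hη : ∀ᵐ ω ∂P, IsCompassPath μ (Y ω) fun t => η t ω) : WeakConsensusInMean P η := by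
  intro v
  refine ⟨fun t => integrable_dist (aemeasurable_opinion hY hη t v)
    (aemeasurable_opinion hY hη t (v + 1)), ?_⟩
  set a : ℝ≥0 → ℝ := fun t => ∫ ω, dist (η t ω v) (η t ω (v + 1)) ∂P with ha
  have hlim : ∀ t : ℝ≥0, Tendsto (fun m : ℕ => meanGap μ (1 / m) ⌈t * m⌉₊) atTop (𝓝 (a t)) :=
    fun t => tendsto_meanGap hY hη t v
  have ha0 : ∀ t, 0 ≤ a t := fun t => integral_nonneg fun ω => dist_nonneg
  have hanti : Antitone a := fun s t hst => by
    refine le_of_tendsto_of_tendsto' (hlim t) (hlim s) fun m => ?_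
    exact antitone_meanGap _ hμ0 hμ1 (Nat.ceil_mono (mul_le_mul_left hst _))
  -- The discrete inequality survives m → ∞ because the probability of the pattern does not involve
  -- m.
  have hkey : ∀ N Q : ℕ, 1 ≤ N → (N : ℝ) ^ 5 * (1 / μ + 4) ≤ Q → ∀ t : ℝ≥0,
      patternProb N Q * ((N * (N + 1) / 2 : ℝ) * a t - (N + 1))
        ≤ N ^ 2 * (a t - a (t + (2 * Q : ℕ))) := by
    intro N Q hN hQ t
    refine le_of_tendsto_of_tendsto
      ((((hlim t).const_mul _).sub_const _).const_mul _)
      (((hlim t).sub (hlim (t + (2 * Q : ℕ)))).const_mul _) ?_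
    filter_upwards [eventually_ge_atTop 1] with m hm
    have h1 := patternProb_mul_le hμ0 hμ1 hN hm hQ ⌈t * m⌉₊
    have h2 : ⌈(t + (2 * Q : ℕ)) * (m : ℝ≥0)⌉₊ = ⌈t * m⌉₊ + Q * (2 * m) := by
      rw [← Nat.ceil_add_natCast zero_le]
      congr 1
      push_cast
      ring
    rw [h2]
    exact h1
  have hbdd : BddBelow (Set.range a) := ⟨0, by rintro _ ⟨t, rfl⟩; exact ha0 t⟩
  have hc := tendsto_atTop_ciInf hanti hbdd
  set c : ℝ := ⨅ t, a t with hc_def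
  have hc0 : 0 ≤ c := le_ciInf ha0
  suffices c = 0 by rwa [this] at hc
  refine le_antisymm ?_ hc0
  have hcN : ∀ N : ℕ, 1 ≤ N → c ≤ 2 / N := by
    intro N hN
    obtain ⟨Q, hQ⟩ := exists_nat_ge ((N : ℝ) ^ 5 * (1 / μ + 4))
    have hc' : Tendsto (fun t : ℝ≥0 => a (t + (2 * Q : ℕ))) atTop (𝓝 c) :=
      hc.comp (tendsto_atTop_mono (fun t => le_self_add) tendsto_id)
    have t1 : Tendsto (fun t => patternProb N Q * ((N * (N + 1) / 2 : ℝ) * a t - (N + 1))) atTop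
        (𝓝 (patternProb N Q * ((N * (N + 1) / 2 : ℝ) * c - (N + 1)))) :=
      ((hc.const_mul _).sub_const _).const_mul _
    have t2 : Tendsto (fun t : ℝ≥0 => (N : ℝ) ^ 2 * (a t - a (t + (2 * Q : ℕ)))) atTop
        (𝓝 ((N : ℝ) ^ 2 * (c - c))) := (hc.sub hc').const_mul _
    have h1 := le_of_tendsto_of_tendsto' t1 t2 (hkey N Q hN hQ)
    -- Since a(t) and a(t + 2Q) have the same limit, what remains is N(N+1)/2 · c ≤ N + 1.
    rw [sub_self, mul_zero] at h1
    have h2 := nonpos_of_mul_nonpos_right h1 (patternProb_pos N Q)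
    have hN0 : (0 : ℝ) < N := by exact_mod_cast hN
    rw [le_div_iff₀ hN0]
    nlinarith
  refine ge_of_tendsto (tendsto_const_div_atTop_nhds_zero_nat (2 : ℝ)) ?_
  filter_upwards [eventually_ge_atTop 1] with N hN using hcN N hN

end Model

/-! ### Absence of strong consensus -/

section NoStrongConsensus

variable {μ : ℝ}

lemma integrable_dist_approx (h h' : ℝ) (j j' : ℕ) (v v' : ℤ) :
    Integrable (fun y => dist (approx μ h y j v) (approx μ h' y j' v')) driveLaw :=
  integrable_dist (measurable_approx μ h j v).aemeasurable
    (measurable_approx μ h' j' v').aemeasurable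

/-- Opinions in the discretized model at vertices that are far apart are not close in the mean. -/
lemma half_le_integral_dist_approx (h : ℝ) (j : ℕ) :
    1 / 2 ≤ ∫ y, dist (approx μ h y j 0) (approx μ h y j (2 * j + 1)) ∂driveLaw := by
  set D : Drive → ℝ := fun y => dist (approx μ h y j 0) (approx μ h y j (2 * j + 1)) with hD
  have hDi : Integrable D driveLaw := integrable_dist_approx _ _ _ _ _ _
  have hDm : Measurable D := (measurable_approx μ h j _).dist (measurable_approx μ h j _)
  have hrot := measurePreserving_rotate (j + 1)
  have h1 : ∫ y, D (rotate (j + 1) y) ∂driveLaw = ∫ y, D y ∂driveLaw := by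
    conv_rhs => rw [← hrot.map_eq]
    rw [integral_map hrot.measurable.aemeasurable hDm.aestronglyMeasurable]
  -- With the boundary at j + 1, vertex 0 has not felt the rotation after j steps, while the opinion
  -- at 2j + 1 is turned exactly into its antipode; the distances from a point to two antipodes add
  -- up to at least 1.
  have h2 : ∀ y, 1 ≤ D y + D (rotate (j + 1) y) := by
    intro y
    rw [hD]
    simp only
    rw [approx_rotate_of_lt μ h _ y j 0 (by omega),
      approx_rotate_of_ge μ h _ y j (2 * j + 1) (by omega)]
    have h3 : dist (approx μ h y j (2 * j + 1))
        (approx μ h y j (2 * j + 1) + ((1 : ℝ) : Opinion)) = 1 := by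
      rw [dist_comm, dist_eq_norm, add_sub_cancel_left, norm_coe_eq_abs (by simp)]
      simp
    have h4 := dist_triangle_left (approx μ h y j (2 * j + 1))
      (approx μ h y j (2 * j + 1) + ((1 : ℝ) : Opinion)) (approx μ h y j 0)
    linarith
  have hDi' : Integrable (fun y => D (rotate (j + 1) y)) driveLaw :=
    hrot.integrable_comp_of_integrable hDi
  have h4 : ∫ _y, (1 : ℝ) ∂driveLaw ≤ ∫ y, (D y + D (rotate (j + 1) y)) ∂driveLaw :=
    integral_mono (integrable_const 1) (hDi.add hDi') h2
  rw [integral_add hDi hDi', h1] at h4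
  simp only [integral_const, probReal_univ, smul_eq_mul, mul_one] at h4
  linarith

variable {Ω : Type*} [MeasurableSpace Ω] {P : Measure Ω} [IsProbabilityMeasure P]
  {η : ℝ≥0 → Ω → ℤ → Opinion} {Y : Ω → Drive}

/-- Distances are at most 1, so the mean is at most ε/2 plus the probability of a distance of at
least ε/2. -/
lemma tendsto_integral_dist_of_tendstoInMeasure {X : ℝ≥0 → Ω → Opinion} {L : Ω → Opinion}
    (hX : ∀ t, AEMeasurable (X t) P) (hL : AEMeasurable L P)
    (h : TendstoInMeasure P X atTop L) :
    Tendsto (fun t => ∫ ω, dist (X t ω) (L ω) ∂P) atTop (𝓝 0) := by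
  rw [tendstoInMeasure_iff_measureReal_dist] at h
  rw [Metric.tendsto_nhds]
  intro ε hε
  have h1 := h (ε / 2) (by positivity)
  filter_upwards [h1.eventually_lt_const (by positivity : (0 : ℝ) < ε / 2)] with t ht
  have hint := integrable_dist (hX t) hL
  rw [Real.dist_eq, sub_zero, abs_of_nonneg (integral_nonneg fun ω => dist_nonneg)]
  have hms : NullMeasurableSet {ω | ε / 2 ≤ dist (X t ω) (L ω)} P :=
    nullMeasurableSet_le aemeasurable_const ((hX t).dist hL)
  have h2 : ∀ ω, dist (X t ω) (L ω)
      ≤ ε / 2 + {ω | ε / 2 ≤ dist (X t ω) (L ω)}.indicator (fun _ => (1 : ℝ)) ω := by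
    intro ω
    by_cases hω : ε / 2 ≤ dist (X t ω) (L ω)
    · rw [Set.indicator_of_mem (show ω ∈ {ω | ε / 2 ≤ dist (X t ω) (L ω)} from hω)]
      linarith [dist_le_one (X t ω) (L ω)]
    · rw [Set.indicator_of_notMem (show ω ∉ {ω | ε / 2 ≤ dist (X t ω) (L ω)} from hω)]
      linarith
  have hind : Integrable ({ω | ε / 2 ≤ dist (X t ω) (L ω)}.indicator fun _ => (1 : ℝ)) P :=
    (integrable_const 1).indicator₀ hms
  have h3 := integral_mono hint ((integrable_const (ε / 2)).add hind) h2
  simp only [Pi.add_apply] at h3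
  rw [integral_add (integrable_const _) hind, integral_indicator₀ hms, setIntegral_const] at h3
  simp only [integral_const, probReal_univ, smul_eq_mul, mul_one, one_mul] at h3
  linarith

/-- The mean distance from a random opinion is `1`-Lipschitz for the mean distance. -/
lemma abs_integral_dist_sub_le {W X Z : Ω → Opinion} (hW : AEMeasurable W P)
    (hX : AEMeasurable X P) (hZ : AEMeasurable Z P) :
    |∫ ω, dist (W ω) (X ω) ∂P - ∫ ω, dist (W ω) (Z ω) ∂P| ≤ ∫ ω, dist (X ω) (Z ω) ∂P := by
  rw [← integral_sub (integrable_dist hW hX) (integrable_dist hW hZ)]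
  refine (abs_integral_le_integral_abs).trans ?_
  refine integral_mono ((integrable_dist hW hX).sub (integrable_dist hW hZ)).abs
    (integrable_dist hX hZ) fun ω => ?_
  simp only
  rw [dist_comm (W ω) (X ω), dist_comm (W ω) (Z ω)]
  exact abs_dist_sub_le _ _ _

/-- `L` need not be a function of the drive, so translation invariance cannot be applied to it
directly. It is reached as a limit of opinions at the vertex under consideration, whose joint law
with the discretization at that vertex is invariant. -/
theorem not_strongConsensusInProbability (hY : HasLaw Y driveLaw P)
    (hη : ∀ᵐ ω ∂P, IsCompassPath μ (Y ω) fun t => η t ω) :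
    ¬ StrongConsensusInProbability P η := by
  rintro ⟨L, hL, hlim⟩
  have hηm := aemeasurable_opinion hY hη
  have hηL : ∀ v, Tendsto (fun t => ∫ ω, dist (η t ω v) (L ω) ∂P) atTop (𝓝 0) := fun v =>
    tendsto_integral_dist_of_tendstoInMeasure (fun t => hηm t v) hL (hlim v)
  have hap := fun (h : ℝ) (j : ℕ) (v : ℤ) => aemeasurable_approx_comp (μ := μ) hY h j v
  -- the mean distance from the limit does not depend on the vertex
  have hstat : ∀ (h : ℝ) (j : ℕ) (v : ℤ), ∫ ω, dist (approx μ h (Y ω) j v) (L ω) ∂P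
      = ∫ ω, dist (approx μ h (Y ω) j 0) (L ω) ∂P := by
    intro h j v
    have e1 : ∀ (h' : ℝ) (j' : ℕ) (v : ℤ),
        ∫ ω, dist (approx μ h (Y ω) j v) (approx μ h' (Y ω) j' v) ∂P
        = ∫ y, dist (approx μ h y j 0) (approx μ h' y j' 0) ∂driveLaw := by
      intro h' j' v
      have hm : ∀ e, Measurable fun y => dist (approx μ h y j e) (approx μ h' y j' e) := fun e =>
        (measurable_approx μ h j e).dist (measurable_approx μ h' j' e)
      have h1 := integral_eq_of_translate
        (F := fun y e => dist (approx μ h y j e) (approx μ h' y j' e)) hm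
        (fun y e => by simp only [approx_translate]) v
      rw [← h1, ← hY.map_eq, integral_map hY.aemeasurable (hm v).aestronglyMeasurable]
    have e2 : ∀ (t : ℝ≥0) (v : ℤ), ∫ ω, dist (approx μ h (Y ω) j v) (η t ω v) ∂P
        = ∫ ω, dist (approx μ h (Y ω) j 0) (η t ω 0) ∂P := by
      intro t v
      have hae := ae_eventually_approx_eq hY hη t
      have hT : ∀ v : ℤ, Tendsto (fun m : ℕ => ∫ ω, dist (approx μ h (Y ω) j v)
          (approx μ (1 / m) (Y ω) ⌈t * m⌉₊ v) ∂P) atTop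
          (𝓝 (∫ ω, dist (approx μ h (Y ω) j v) (η t ω v) ∂P)) := fun v =>
        tendsto_integral_dist (X := fun _ ω => approx μ h (Y ω) j v) (fun _ => hap h j v)
          (fun m => hap _ _ v) (Eventually.of_forall fun ω => Eventually.of_forall fun m => rfl)
          (hae.mono fun ω hω => hω v)
      refine tendsto_nhds_unique (hT v) ((hT 0).congr fun m => ?_)
      rw [e1, e1]
    -- Here strong consensus enters: at every vertex the opinion may be replaced by the same `L` in
    -- the limit.
    have e3 : ∀ v, Tendsto (fun t => ∫ ω, dist (approx μ h (Y ω) j v) (η t ω v) ∂P) atTop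
        (𝓝 (∫ ω, dist (approx μ h (Y ω) j v) (L ω) ∂P)) := fun v => by
      rw [tendsto_iff_dist_tendsto_zero]
      exact squeeze_zero (fun _ => dist_nonneg)
        (fun t => abs_integral_dist_sub_le (hap h j v) (hηm t v) hL) (hηL v)
    exact tendsto_nhds_unique (e3 v) ((e3 0).congr fun t => (e2 t v).symm)
  -- a discretization that is close to the limit
  obtain ⟨t, ht⟩ := ((hηL 0).eventually_lt_const (by norm_num : (0 : ℝ) < 1 / 4)).exists
  have hT : Tendsto (fun m : ℕ => ∫ ω, dist (approx μ (1 / m) (Y ω) ⌈t * m⌉₊ 0) (L ω) ∂P) atTop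
      (𝓝 (∫ ω, dist (η t ω 0) (L ω) ∂P)) :=
    tendsto_integral_dist (Z := fun _ => L) (fun m => hap _ _ 0) (fun _ => hL)
      ((ae_eventually_approx_eq hY hη t).mono fun ω hω => hω 0)
      (Eventually.of_forall fun ω => Eventually.of_forall fun m => rfl)
  obtain ⟨m, hm⟩ := (hT.eventually_lt_const ht).exists
  set h : ℝ := 1 / m with hh
  set j : ℕ := ⌈t * m⌉₊ with hj
  have h1 := half_le_integral_dist_approx (μ := μ) h j
  rw [← hY.map_eq, integral_map hY.aemeasurable
    ((measurable_approx μ h j _).dist (measurable_approx μ h j _)).aestronglyMeasurable] at h1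
  have i1 := integrable_dist (hap h j 0) hL
  have i2 := integrable_dist (hap h j (2 * j + 1)) hL
  -- Both mean distances to `L` equal the one at vertex 0, which is below 1/4, so their sum is below
  -- the lower bound 1/2.
  have h2 := integral_mono (integrable_dist (hap h j 0) (hap h j (2 * j + 1))) (i1.add i2)
    fun ω => dist_triangle_right (approx μ h (Y ω) j 0) (approx μ h (Y ω) j (2 * j + 1)) (L ω)
  simp only [Pi.add_apply] at h2
  rw [integral_add i1 i2, hstat h j (2 * j + 1)] at h2
  linarith

end NoStrongConsensus

end Compass

theorem theorem1 {Ω : Type*} [MeasurableSpace Ω] (P : Measure Ω) [IsProbabilityMeasure P]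
    (μ : ℝ) (hμ0 : 0 < μ) (hμ1 : μ ≤ 1 / 2) (η : ℝ≥0 → Ω → ℤ → Compass.Opinion)
    (hη : Compass.IsUniformCompassModel P μ η) :
    Compass.WeakConsensusInMean P η ∧ ¬ Compass.StrongConsensusInProbability P η := by
  obtain ⟨Y, hY, hpath⟩ := hη
  exact ⟨Compass.weakConsensusInMean hμ0 hμ1 hY hpath,
    Compass.not_strongConsensusInProbability hY hpath⟩
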